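/- Let $\rho$ be a positive Borel measure on the real line, all of whose moments are finite, normalized to total mass $1$, with recurrence coefficients $\{a_n\}_{n\ge1}$, $\{b_n\}_{n\ge0}$, $a_n>0$, $b_n\in\mathbb R$. That is, the polynomials defined by $p_{-1}=0$, $p_0=1$ and $$a_{n+1}p_{n+1}(x)+b_np_n(x)+a_np_{n-1}(x)=x\,p_n(x)\qquad(n\ge 0)$$ are orthonormal with respect to $\rho$. Let $a>0$, $b\in\mathbb R$ and let $n_0\ge0$ be an integer. For $z\in\mathbb C\setminus\{0\}$ put $x=a(z+1/z)+b$, define $\psi_0(z)=1$ and $$\psi_n(z)=\frac{a}{a_n}\left[\frac1z\,\psi_{n-1}(z)+\left(\Big(1-\frac{a_n^2}{a^2}\Big)z-\frac{b_{n-1}-b}{a}\right)p_{n-1}(x)\right]\qquad(n\ge1),$$ and let $\hat\psi_n(z)=z^n\psi_n(z)$. For a polynomial $f$ with real coefficients and $f(0)\neq 0$, say that $\rho$ is of Bernstein–Szegő form with generating polynomial $f$ if $\rho$ is the sum of the absolutely continuous measure on $(b-2a,b+2a)$ given by $$\sigma(\theta)\,dx,\qquad x=2a\cos\theta+b,\quad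 0<\theta<\pi,\qquad \sigma(\theta)=\frac{\sin\theta}{a\pi\,|f(e^{i\theta})|^2},$$ and of finitely many point masses $\rho_i>0$ at the points $x_i=a(z_i+1/z_i)+b$, where $z_i$ runs over the distinct real zeros of $f$ in $|z|<1$, with $$\rho_i=\frac{z_i-1/z_i}{a\,\frac{d}{dx}\big(f(z)f(1/z)\big)}\Bigg|_{x=x_i},$$ where, in the derivative, $z=z(x)$ is the solution of $x=a(z+1/z)+b$ with $|z|<1$. Consider also the following property of a real polynomial $f$: (Z) $f(0)>0$; all complex zeros of $f$ in $|z|\le1$ are real and simple; and for $z\ne0,\pm1$ the numbers $f(z)$ and $f(1/z)$ are not both zero. Then $\hat\psi_{n_0}$ is (the restriction to $z\neq0$ of) a polynomial with real coefficients, again denoted $\hat\psi_{n_0}$, and the following hold. 1. $a_{n+1}=a$ and $b_n=b$ for all $n\ge n_0$ if and only if $\rho$ is of Bernstein–Szegő form with generating polynomial $\hat\psi_{n_0}$. 2. More generally, if $\rho$ is of Bernstein–Szegő form with some generating real polynomial $f$ of degree at most $2n_0$ that has property (Z), then $a_{n+1}=a$ and $b_n=b$ for all $n\ge n_0$, and $f=\hat\psi_{n_0}$.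 3. $\hat\psi_{n_0}$ has degree at most $2n_0$. For $n_0\ge1$: if $a_{n_0}=a$ and $b_{n_0-1}\ne b$, the degree is $2n_0-1$; if $a_{n_0}\neq a$, the degree is $2n_0$. 4. $\hat\psi_{n_0}$ has property (Z). In particular, the zeros in $|z|<1$ used in part 1 are all the complex zeros of $\hat\psi_{n_0}$ there. 5. Suppose that $a_{n+1}=a$ and $b_n=b$ for all $n\ge n_0$. If $z_0\in\mathbb C\setminus\{1,-1\}$ is a zero of $\hat\psi_{n_0}$ and $x_0=a(z_0+1/z_0)+b$, then $$p_n(x_0)=\frac{z_0^{\,n+1}\,\hat\psi_{n_0}(1/z_0)}{z_0-1/z_0}\qquad(n\ge n_0).$$ If moreover $|z_0|<1$, then $p_n(x_0)$ decays exponentially to zero: there is a constant $K$ with $|p_n(x_0)|\le K|z_0|^n$ for all $n\ge0$. -/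

import Mathlib

open MeasureTheory Polynomial

noncomputable section

/-- The polynomials `p_n` generated by the recurrence
`a_{n+1} p_{n+1} + b_n p_n + a_n p_{n-1} = x p_n` with `p_{-1} = 0` and `p_0 = 1`.
Here `A n = a_n` for `n ≥ 1` (the entry `A 0` is never used) and `B n = b_n` for `n ≥ 0`. -/
def recPoly (A B : ℕ → ℝ) : ℕ → ℝ[X]
  | 0 => 1
  | 1 => C (A 1)⁻¹ * (X - C (B 0))
  | n + 2 => C (A (n + 2))⁻¹ *
      ((X - C (B (n + 1))) * recPoly A B (n + 1) - C (A (n + 1)) * recPoly A B n)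

/-- `A` and `B` are the recurrence coefficients of the positive Borel measure `ρ`: all moments of
`ρ` are finite, `a_n > 0` for `n ≥ 1`, and the polynomials generated by the three-term recurrence
are orthonormal in `L²(ρ)`. As `p_0 = 1`, the measure has total mass one. -/
structure HasRecurrenceCoefficients (ρ : Measure ℝ) (A B : ℕ → ℝ) : Prop where
  integrable_pow : ∀ n : ℕ, Integrable (fun x : ℝ => x ^ n) ρ
  pos : ∀ n : ℕ, 1 ≤ n → 0 < A n
  orthonormal : ∀ m n : ℕ,
    ∫ x, (recPoly A B m).eval x * (recPoly A B n).eval x ∂ρ = if m = n then 1 else 0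

/-- The map `z ↦ x = a (z + 1/z) + b`. -/
def xOf (a b : ℝ) (z : ℂ) : ℂ := a * (z + 1 / z) + b

/-- The functions `ψ_n(z)`, `z ≠ 0`: `ψ_0 = 1` and
`ψ_n(z) = (a / a_n) (ψ_{n-1}(z) / z + ((1 - a_n² / a²) z - (b_{n-1} - b) / a) p_{n-1}(x))`. -/
def psi (A B : ℕ → ℝ) (a b : ℝ) : ℕ → ℂ → ℂ
  | 0, _ => 1
  | n + 1, z => ((a / A (n + 1) : ℝ) : ℂ) *
      ((1 / z) * psi A B a b n z +
        (((1 - A (n + 1) ^ 2 / a ^ 2 : ℝ) : ℂ) * z - (((B n - b) / a : ℝ) : ℂ)) *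
          aeval (xOf a b z) (recPoly A B n))

/-- `ψ̂_n(z) = z^n ψ_n(z)`, for `z ≠ 0`. -/
def psiHat (A B : ℕ → ℝ) (a b : ℝ) (n : ℕ) (z : ℂ) : ℂ := z ^ n * psi A B a b n z

/-- The inverse `x ↦ z` of `x = a (z + 1/z) + b` with `|z| ≤ 1`, for real `x` with
`|x - b| ≥ 2a`: the branch `z = t - √(t² - 1)`, `t = (x - b) / (2a)`, in which the square root
has the sign of `t`. -/
def zOf (a b x : ℝ) : ℝ :=
  if 0 ≤ x - b then (x - b) / (2 * a) - √(((x - b) / (2 * a)) ^ 2 - 1)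
  else (x - b) / (2 * a) + √(((x - b) / (2 * a)) ^ 2 - 1)

/-- The density `σ(θ) = sin θ / (a π |f(e^{iθ})|²)`. -/
def bsDensity (a : ℝ) (f : ℝ[X]) (θ : ℝ) : ℝ :=
  Real.sin θ / (a * Real.pi * ‖aeval (Complex.exp (θ * Complex.I)) f‖ ^ 2)

/-- The canonical mass attached to a real zero `z₀`, `0 < |z₀| < 1`, of `f`, namely
`(z₀ - 1/z₀) / (a * d/dx (f(z) f(1/z)))`, where `z = z(x)` and the derivative is taken at
`x₀ = a (z₀ + 1/z₀) + b`. -/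
def canonicalMass (a b : ℝ) (f : ℝ[X]) (z₀ : ℝ) : ℝ :=
  (z₀ - 1 / z₀) /
    (a * deriv (fun x : ℝ => f.eval (zOf a b x) * f.eval (1 / zOf a b x))
      (a * (z₀ + 1 / z₀) + b))

/-- The real zeros of `f` in the open unit disk. -/
def diskZeros (f : ℝ[X]) : Finset ℝ := f.roots.toFinset.filter (fun z => |z| < 1)

/-- `ρ` is the Bernstein–Szegő type measure with parameters `a`, `b` generated by `f`: it has
density `σ(θ)` with respect to `dx` at `x = 2a cos θ + b`, `0 < θ < π`, and is otherwise a sum of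
point masses at `a (z + 1/z) + b`, `z` running over the zeros of `f` in the unit disk, each one
with its (positive) canonical mass. -/
structure IsBernsteinSzego (ρ : Measure ℝ) (a b : ℝ) (f : ℝ[X]) : Prop where
  mass_pos : ∀ z ∈ diskZeros f, 0 < canonicalMass a b f z
  eq : ρ =
    (volume.restrict (Set.Ioo (b - 2 * a) (b + 2 * a))).withDensity
        (fun x => ENNReal.ofReal (bsDensity a f (Real.arccos ((x - b) / (2 * a))))) +
      ∑ z ∈ diskZeros f, ENNReal.ofReal (canonicalMass a b f z) •
        Measure.dirac (a * (z + 1 / z) + b)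

/-- `f(0) > 0`, all complex zeros of `f` in `|z| ≤ 1` are real and simple, and, except possibly
for `z = ±1`, `f(z)` and `f(1/z)` do not vanish together. -/
structure HasJostZeros (f : ℝ[X]) : Prop where
  eval_zero_pos : 0 < f.eval 0
  real_of_zero : ∀ z : ℂ, ‖z‖ ≤ 1 → aeval z f = 0 → z.im = 0
  simple_of_zero : ∀ z : ℂ, ‖z‖ ≤ 1 → aeval z f = 0 → aeval z (derivative f) ≠ 0
  no_common_zero : ∀ z : ℂ, z ≠ 0 → z ≠ 1 → z ≠ -1 → aeval z f = 0 → aeval (1 / z) f ≠ 0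

end

/-! The key is the closed form `psi_eq`: ψ_n(z) = p_n(x) - (z/a) a_n p_{n-1}(x). Once the
coefficients equal a and b, the recurrence for ψ̂_n is stationary, so all ψ̂_n with n ≥ n₀ are one
polynomial f. Since x is invariant under z ↦ 1/z, eliminating p_{n-1} between z and 1/z gives (z -
1/z) p_n(x) = z^(n+1) f(1/z) - z^(-n-1) f(z) (`sub_mul_aeval_recPoly`), which yields the values and
the decay of p_n at the zeros of f. At such a zero p_n = (z/a) a_n p_{n-1}, and the
Christoffel–Darboux formulas then force the zeros in the closed disk to be real and simple and the
masses to be positive (`hasJostZeros_jostPoly`, `canonicalMass_jostPoly_pos`).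

Constant coefficients imply the Bernstein–Szegő form: for deg r ≤ n the identity turns the integral
of p_n r against σ into a circle average of (z² - 1) z^n r(x) / f(z). The residue at 0 gives r_n a^n
/ f(0), with r_n the coefficient of x^n in r, and the residues at the zeros of f in the disk are
cancelled by the point masses (`HasJostZeros.integral_bs`). So the p_n with n ≥ n₀ are orthonormal
for the Bernstein–Szegő measure. Running the recurrence downwards gives the same for all n, hence ρ
has the same moments as this compactly supported measure and equals it.

Conversely, for f of degree at most 2n₀ with property (Z), Chebyshev polynomials of the second kind
produce polynomials q_m (`genPoly`) satisfying the same identity and a recurrence with constant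
coefficients. The same residue computation makes them orthogonal. The degree bound gives q_n degree
n for n ≥ n₀, so q_n = p_n once leading coefficients are compared. Comparing the two recurrences
gives a_{n+1} = a and b_n = b, and f is recovered from q_{n₀} and q_{n₀-1}. -/

noncomputable section

/-! ### The polynomials `p_n` -/

/-- The term `a_n p_{n-1}` of the recurrence, with `p_{-1} = 0`. -/
def prevTerm (A B : ℕ → ℝ) : ℕ → ℝ[X]
  | 0 => 0
  | n + 1 => C (A (n + 1)) * recPoly A B n

theorem C_mul_recPoly_succ {A : ℕ → ℝ} (B : ℕ → ℝ) (hA : ∀ n, 1 ≤ n → 0 < A n) (n : ℕ) :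
    C (A (n + 1)) * recPoly A B (n + 1) =
      (X - C (B n)) * recPoly A B n - prevTerm A B n := by
  have h : C (A (n + 1)) * C (A (n + 1))⁻¹ = 1 := by
    rw [← C_mul, mul_inv_cancel₀ (hA (n + 1) (by lia)).ne', C_1]
  cases n with
  | zero => simp only [recPoly, prevTerm, zero_add] at h ⊢; rw [← mul_assoc, h]; ring
  | succ n => simp only [recPoly, prevTerm] at h ⊢; rw [← mul_assoc, h]; ring

theorem natDegree_recPoly_le {A : ℕ → ℝ} (B : ℕ → ℝ) : ∀ n,
    (recPoly A B n).natDegree ≤ n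
  | 0 => by simp [recPoly]
  | 1 => by
    simp only [recPoly]
    exact (natDegree_C_mul_le _ _).trans (natDegree_X_sub_C_le _)
  | n + 2 => by
    have h0 := natDegree_recPoly_le (A := A) B n
    have h1 := natDegree_recPoly_le (A := A) B (n + 1)
    simp only [recPoly]
    refine (natDegree_C_mul_le _ _).trans ((natDegree_sub_le _ _).trans (max_le ?_ ?_))
    · refine natDegree_mul_le.trans ?_
      have := natDegree_X_sub_C_le (B (n + 1))
      lia
    · exact (natDegree_C_mul_le _ _).trans (by lia)

theorem coeff_prevTerm_eq_zero {A : ℕ → ℝ} (B : ℕ → ℝ) (n m : ℕ) (h : n ≤ m) :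
    (prevTerm A B n).coeff m = 0 := by
  cases n with
  | zero => simp [prevTerm]
  | succ n =>
    apply coeff_eq_zero_of_natDegree_lt
    exact ((natDegree_C_mul_le _ _).trans (natDegree_recPoly_le B n)).trans_lt h

theorem coeff_recPoly_succ {A : ℕ → ℝ} (B : ℕ → ℝ) (hA : ∀ n, 1 ≤ n → 0 < A n) (n : ℕ) :
    A (n + 1) * (recPoly A B (n + 1)).coeff (n + 1) = (recPoly A B n).coeff n := by
  have h := congrArg (fun p => p.coeff (n + 1)) (C_mul_recPoly_succ B hA n)
  simp only [coeff_C_mul, coeff_sub, sub_mul, coeff_X_mul,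
    coeff_prevTerm_eq_zero B n (n + 1) (by lia)] at h
  rw [h, coeff_eq_zero_of_natDegree_lt ((natDegree_recPoly_le B n).trans_lt (Nat.lt_succ_self n))]
  ring

theorem coeff_recPoly_pos {A : ℕ → ℝ} (B : ℕ → ℝ) (hA : ∀ n, 1 ≤ n → 0 < A n) (n : ℕ) :
    0 < (recPoly A B n).coeff n := by
  induction n with
  | zero => simp [recPoly]
  | succ n ih =>
    rw [← coeff_recPoly_succ B hA n] at ih
    exact pos_of_mul_pos_right ih (hA (n + 1) (by lia)).le

theorem exists_eq_sum_recPoly {A : ℕ → ℝ} (B : ℕ → ℝ) (hA : ∀ n, 1 ≤ n → 0 < A n) (N : ℕ) :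
    ∀ q : ℝ[X], q.natDegree < N →
      ∃ c : ℕ → ℝ, q = ∑ k ∈ Finset.range N, C (c k) * recPoly A B k := by
  induction N with
  | zero => intro q hq; lia
  | succ N ih =>
    intro q hq
    set e := q.coeff N / (recPoly A B N).coeff N with he
    have hpos := coeff_recPoly_pos B hA N
    set d := q - C e * recPoly A B N with hd
    have hdN : d.natDegree ≤ N := by
      refine (natDegree_sub_le _ _).trans (max_le (by lia) ?_)
      exact (natDegree_C_mul_le _ _).trans (natDegree_recPoly_le B N)
    have hdc : d.coeff N = 0 := by
      simp only [hd, coeff_sub, coeff_C_mul, he]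
      field_simp
      ring
    have hex : ∃ c : ℕ → ℝ, d = ∑ k ∈ Finset.range N, C (c k) * recPoly A B k := by
      by_cases hd0 : d = 0
      · exact ⟨0, by simp [hd0]⟩
      · refine ih d (lt_of_le_of_ne hdN fun h => hd0 ?_)
        rw [← leadingCoeff_eq_zero, leadingCoeff, h, hdc]
    obtain ⟨c, hc⟩ := hex
    refine ⟨fun k => if k = N then e else c k, ?_⟩
    have hsum : ∑ k ∈ Finset.range N, C (if k = N then e else c k) * recPoly A B k = d := by
      rw [hc]
      refine Finset.sum_congr rfl fun k hk => ?_
      rw [if_neg (Finset.mem_range.1 hk).ne]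
    rw [Finset.sum_range_succ, hsum]
    simp [hd]

/-- Two consecutive polynomials have no common zero. -/
theorem aeval_prevTerm_ne_zero {A : ℕ → ℝ} (B : ℕ → ℝ) (hA : ∀ n, 1 ≤ n → 0 < A n) (x : ℂ)
    (n : ℕ) (hp : aeval x (recPoly A B n) = 0) : aeval x (prevTerm A B n) ≠ 0 := by
  induction n with
  | zero => simp [recPoly] at hp
  | succ n ih =>
    intro hT
    have hA' : (A (n + 1) : ℂ) ≠ 0 := by exact_mod_cast (hA (n + 1) (by lia)).ne'
    have h0 : aeval x (recPoly A B n) = 0 := by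
      simpa [prevTerm, hA'] using hT
    have h := congrArg (aeval x) (C_mul_recPoly_succ B hA n)
    simp only [map_mul, map_sub, hp, h0, mul_zero, zero_sub] at h
    exact ih h0 (neg_eq_zero.1 h.symm)

/-- The Christoffel–Darboux formula at `x` and its conjugate. -/
theorem im_mul_sum_sq_norm_recPoly {A : ℕ → ℝ} (B : ℕ → ℝ) (hA : ∀ n, 1 ≤ n → 0 < A n) (x : ℂ)
    (n : ℕ) : x.im * ∑ k ∈ Finset.range n, Complex.normSq (aeval x (recPoly A B k)) =
      (aeval x (recPoly A B n) * starRingEnd ℂ (aeval x (prevTerm A B n))).im := by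
  induction n with
  | zero => simp [prevTerm]
  | succ n ih =>
    have h := congrArg (aeval x) (C_mul_recPoly_succ B hA n)
    simp only [map_mul, map_sub, aeval_C, aeval_X] at h
    rw [Finset.sum_range_succ, mul_add, ih, prevTerm, map_mul, map_mul, aeval_C]
    have : aeval x (recPoly A B (n + 1)) * (starRingEnd ℂ (algebraMap ℝ ℂ (A (n + 1))) *
        starRingEnd ℂ (aeval x (recPoly A B n))) =
        (algebraMap ℝ ℂ (A (n + 1)) * aeval x (recPoly A B (n + 1))) *
          starRingEnd ℂ (aeval x (recPoly A B n)) := by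
      simp only [Complex.coe_algebraMap, Complex.conj_ofReal]
      ring
    rw [this, h]
    simp [Complex.normSq_apply]
    ring

/-- The confluent Christoffel–Darboux formula. -/
theorem sum_sq_recPoly {A : ℕ → ℝ} (B : ℕ → ℝ) (hA : ∀ n, 1 ≤ n → 0 < A n) (n : ℕ) :
    ∑ k ∈ Finset.range n, recPoly A B k ^ 2 =
      derivative (recPoly A B n) * prevTerm A B n -
        recPoly A B n * derivative (prevTerm A B n) := by
  induction n with
  | zero => simp [prevTerm]
  | succ n ih =>
    have h := C_mul_recPoly_succ B hA n
    have h' := congrArg derivative h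
    simp only [derivative_mul, derivative_C, derivative_sub, derivative_X] at h'
    rw [Finset.sum_range_succ, ih, prevTerm, derivative_mul, derivative_C]
    linear_combination recPoly A B n * (-h') + derivative (recPoly A B n) * h

/-! ### Lifting polynomials in `x` to polynomials in `z` -/

/-- For `r` of degree at most `n`, the polynomial `z ^ n * r (a (z + 1/z) + b)`. -/
def joukowskyLift (a b : ℝ) (n : ℕ) (r : ℝ[X]) : ℝ[X] :=
  ∑ k ∈ Finset.range (n + 1), C (r.coeff k) * ((C a * X ^ 2 + C b * X + C a) ^ k * X ^ (n - k))

theorem aeval_joukowskyLift (a b : ℝ) {n : ℕ} {r : ℝ[X]} (hr : r.natDegree ≤ n) {z : ℂ}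
    (hz : z ≠ 0) : aeval z (joukowskyLift a b n r) = z ^ n * aeval (xOf a b z) r := by
  rw [aeval_eq_sum_range' (Nat.lt_succ_of_le hr), joukowskyLift, map_sum, Finset.mul_sum]
  refine Finset.sum_congr rfl fun k hk => ?_
  have hk' : k ≤ n := Nat.lt_succ_iff.1 (Finset.mem_range.1 hk)
  have hx : (a * z ^ 2 + b * z + a : ℂ) = z * xOf a b z := by
    rw [xOf]; field_simp; ring
  simp only [map_mul, map_add, map_pow, aeval_C, aeval_X, Complex.coe_algebraMap, hx, mul_pow,
    Complex.real_smul]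
  rw [← Nat.sub_add_cancel hk', pow_add, Nat.add_sub_cancel]
  ring

theorem eval_zero_joukowskyLift (a b : ℝ) (n : ℕ) (r : ℝ[X]) :
    (joukowskyLift a b n r).eval 0 = r.coeff n * a ^ n := by
  rw [joukowskyLift, eval_finsetSum, Finset.sum_range_succ, Finset.sum_eq_zero]
  · simp
  · intro k hk
    have : n - k ≠ 0 := by have := Finset.mem_range.1 hk; lia
    simp [this]

theorem natDegree_joukowskyLift_le (a b : ℝ) (n : ℕ) (r : ℝ[X]) :
    (joukowskyLift a b n r).natDegree ≤ 2 * n := by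
  refine natDegree_sum_le_of_forall_le _ _ fun k hk => ?_
  have hk' := Finset.mem_range.1 hk
  refine (natDegree_C_mul_le _ _).trans (natDegree_mul_le.trans ?_)
  have h1 : ((C a * X ^ 2 + C b * X + C a : ℝ[X]) ^ k).natDegree ≤ k * 2 :=
    natDegree_pow_le_of_le k (natDegree_quadratic_le)
  rw [natDegree_X_pow]
  lia

/-- The lift is palindromic of formal degree 2n, because x is invariant under z ↦ 1/z. Hence its top
coefficient agrees with its value at 0. This coefficient decides the degree of ψ̂_{n+1}. -/
theorem coeff_two_mul_joukowskyLift (a b : ℝ) (n : ℕ) (r : ℝ[X]) :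
    (joukowskyLift a b n r).coeff (2 * n) = r.coeff n * a ^ n := by
  have hq (k : ℕ) : ((C a * X ^ 2 + C b * X + C a : ℝ[X]) ^ k).natDegree ≤ k * 2 :=
    natDegree_pow_le_of_le k (natDegree_quadratic_le)
  rw [joukowskyLift, finsetSum_coeff, Finset.sum_range_succ, Finset.sum_eq_zero]
  · rw [Nat.sub_self, pow_zero, mul_one, coeff_C_mul, mul_comm 2 n,
      coeff_pow_of_natDegree_le natDegree_quadratic_le]
    simp
  · intro k hk
    have hk' := Finset.mem_range.1 hk
    rw [coeff_C_mul, coeff_eq_zero_of_natDegree_lt (p := _ * _), mul_zero]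
    refine natDegree_mul_le.trans_lt ?_
    rw [natDegree_X_pow]
    have := hq k
    lia

/-! ### The polynomials `ψ̂_n` -/

/-- The polynomial `ψ̂_n`. -/
def jostPoly (A B : ℕ → ℝ) (a b : ℝ) : ℕ → ℝ[X]
  | 0 => 1
  | n + 1 => C (a / A (n + 1)) * (jostPoly A B a b n +
      (C (1 - A (n + 1) ^ 2 / a ^ 2) * X - C ((B n - b) / a)) *
        (X * joukowskyLift a b n (recPoly A B n)))

theorem aeval_jostPoly_eq_psiHat (A B : ℕ → ℝ) (a b : ℝ) (n : ℕ) {z : ℂ} (hz : z ≠ 0) :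
    aeval z (jostPoly A B a b n) = psiHat A B a b n z := by
  induction n with
  | zero => simp [jostPoly, psiHat, psi]
  | succ n ih =>
    rw [jostPoly, map_mul, map_add, ih]
    simp only [map_mul, map_sub, aeval_C, aeval_X,
      aeval_joukowskyLift a b (natDegree_recPoly_le B n) hz, Complex.coe_algebraMap, psiHat, psi]
    push_cast
    linear_combination -((a : ℂ) / A (n + 1)) * z ^ n * psi A B a b n z * mul_inv_cancel₀ hz

/-- In the inductive step, a(z + 1/z) + b - b_n multiplies p_n and assembles with -a_n p_{n-1} into
a_{n+1} p_{n+1}; what remains is -(z/a) a_{n+1} p_n. -/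
theorem psi_eq {A : ℕ → ℝ} (B : ℕ → ℝ) (hA : ∀ n, 1 ≤ n → 0 < A n) {a : ℝ} (ha : 0 < a) (b : ℝ)
    (n : ℕ) {z : ℂ} (hz : z ≠ 0) : psi A B a b n z =
      aeval (xOf a b z) (recPoly A B n) - z / a * aeval (xOf a b z) (prevTerm A B n) := by
  have ha' : (a : ℂ) ≠ 0 := by exact_mod_cast ha.ne'
  induction n with
  | zero => simp [psi, recPoly, prevTerm]
  | succ n ih =>
    have hA' : (A (n + 1) : ℂ) ≠ 0 := by exact_mod_cast (hA (n + 1) (by lia)).ne'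
    have h := congrArg (aeval (xOf a b z)) (C_mul_recPoly_succ B hA n)
    simp only [map_mul, map_sub, aeval_C, aeval_X, Complex.coe_algebraMap] at h
    rw [psi, ih, prevTerm, map_mul, aeval_C, Complex.coe_algebraMap]
    have h2 : aeval (xOf a b z) (recPoly A B (n + 1)) =
        ((xOf a b z - B n) * aeval (xOf a b z) (recPoly A B n) -
          aeval (xOf a b z) (prevTerm A B n)) / A (n + 1) := by
      rw [← h, mul_div_cancel_left₀ _ hA']
    rw [h2]
    push_cast
    generalize aeval (xOf a b z) (recPoly A B n) = p
    generalize aeval (xOf a b z) (prevTerm A B n) = T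
    rw [xOf]
    field_simp
    ring

theorem aeval_jostPoly {A : ℕ → ℝ} (B : ℕ → ℝ) (hA : ∀ n, 1 ≤ n → 0 < A n) {a : ℝ} (ha : 0 < a)
    (b : ℝ) (n : ℕ) {z : ℂ} (hz : z ≠ 0) : aeval z (jostPoly A B a b n) = z ^ n *
      (aeval (xOf a b z) (recPoly A B n) - z / a * aeval (xOf a b z) (prevTerm A B n)) := by
  rw [aeval_jostPoly_eq_psiHat A B a b n hz, psiHat, psi_eq B hA ha b n hz]

theorem xOf_ofReal (a b z : ℝ) : xOf a b z = ((a * (z + 1 / z) + b : ℝ) : ℂ) := by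
  simp [xOf]

theorem xOf_one_div (a b : ℝ) (z : ℂ) : xOf a b (1 / z) = xOf a b z := by
  simp [xOf, add_comm]

theorem aeval_ofReal_complex (p : ℝ[X]) (x : ℝ) : aeval (x : ℂ) p = ((p.eval x : ℝ) : ℂ) := by
  rw [← Complex.coe_algebraMap, aeval_algebraMap_apply, coe_aeval_eq_eval]

theorem eval_jostPoly {A : ℕ → ℝ} (B : ℕ → ℝ) (hA : ∀ n, 1 ≤ n → 0 < A n) {a : ℝ} (ha : 0 < a)
    (b : ℝ) (n : ℕ) {z : ℝ} (hz : z ≠ 0) : (jostPoly A B a b n).eval z = z ^ n *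
      ((recPoly A B n).eval (a * (z + 1 / z) + b) -
        z / a * (prevTerm A B n).eval (a * (z + 1 / z) + b)) := by
  have h := aeval_jostPoly B hA ha b n (z := z) (by exact_mod_cast hz)
  rw [xOf_ofReal] at h
  simp only [aeval_ofReal_complex] at h
  exact_mod_cast h

theorem eval_zero_jostPoly {A : ℕ → ℝ} (B : ℕ → ℝ) (hA : ∀ n, 1 ≤ n → 0 < A n) {a : ℝ}
    (b : ℝ) (n : ℕ) : (jostPoly A B a b n).eval 0 = (recPoly A B n).coeff n * a ^ n := by
  induction n with
  | zero => simp [jostPoly, recPoly]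
  | succ n ih =>
    have hA' := (hA (n + 1) (by lia)).ne'
    have h := coeff_recPoly_succ B hA n
    simp only [jostPoly, eval_mul, eval_C, eval_add, ih, eval_X, zero_mul, mul_zero, add_zero, ← h]
    field_simp
    ring

theorem natDegree_jostPoly_le (A B : ℕ → ℝ) (a b : ℝ) (n : ℕ) :
    (jostPoly A B a b n).natDegree ≤ 2 * n := by
  induction n with
  | zero => simp [jostPoly]
  | succ n ih =>
    refine (natDegree_C_mul_le _ _).trans ((natDegree_add_le _ _).trans (max_le (by lia) ?_))
    refine natDegree_mul_le.trans ?_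
    have h1 : (C (1 - A (n + 1) ^ 2 / a ^ 2) * X - C ((B n - b) / a)).natDegree ≤ 1 := by
      rw [sub_eq_add_neg, ← C_neg]
      exact natDegree_linear_le
    have h2 := natDegree_mul_le (p := (X : ℝ[X])) (q := joukowskyLift a b n (recPoly A B n))
    have h3 := natDegree_joukowskyLift_le a b n (recPoly A B n)
    rw [natDegree_X] at h2
    lia

theorem natDegree_jostPoly_of_ne {A : ℕ → ℝ} (B : ℕ → ℝ) (hA : ∀ n, 1 ≤ n → 0 < A n) {a : ℝ}
    (ha : 0 < a) (b : ℝ) (n : ℕ) (h : A (n + 1) ≠ a) :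
    (jostPoly A B a b (n + 1)).natDegree = 2 * (n + 1) := by
  refine natDegree_eq_of_le_of_coeff_ne_zero (natDegree_jostPoly_le A B a b (n + 1)) ?_
  have hpos := hA (n + 1) (by lia)
  have h0 : (jostPoly A B a b n).coeff (2 * (n + 1)) = 0 :=
    coeff_eq_zero_of_natDegree_lt ((natDegree_jostPoly_le A B a b n).trans_lt (by lia))
  have h1 : (joukowskyLift a b n (recPoly A B n)).coeff (2 * n + 1) = 0 :=
    coeff_eq_zero_of_natDegree_lt ((natDegree_joukowskyLift_le a b n _).trans_lt (by lia))
  rw [jostPoly, coeff_C_mul, coeff_add, h0, sub_mul, coeff_sub, mul_assoc, coeff_C_mul, coeff_C_mul,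
    show 2 * (n + 1) = 2 * n + 1 + 1 by ring, coeff_X_mul, coeff_X_mul, coeff_X_mul, h1,
    coeff_two_mul_joukowskyLift]
  have h2 : 1 - A (n + 1) ^ 2 / a ^ 2 ≠ 0 := by
    rw [sub_ne_zero, ne_comm, ne_eq, div_eq_one_iff_eq (by positivity)]
    intro h3
    exact h ((pow_left_inj₀ hpos.le ha.le two_ne_zero).1 h3)
  have := coeff_recPoly_pos B hA n
  simp only [zero_add, mul_zero, sub_zero]
  positivity

theorem natDegree_jostPoly_of_eq {A : ℕ → ℝ} {B : ℕ → ℝ} (hA : ∀ n, 1 ≤ n → 0 < A n) {a : ℝ}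
    (ha : 0 < a) {b : ℝ} {n : ℕ} (h : A (n + 1) = a) (hB : B n ≠ b) :
    (jostPoly A B a b (n + 1)).natDegree = 2 * (n + 1) - 1 := by
  have hw : jostPoly A B a b (n + 1) = jostPoly A B a b n -
      C ((B n - b) / a) * (X * joukowskyLift a b n (recPoly A B n)) := by
    rw [jostPoly, h, div_self ha.ne', div_self (by positivity), sub_self]
    simp
    ring
  rw [hw, show 2 * (n + 1) - 1 = 2 * n + 1 by lia]
  refine natDegree_eq_of_le_of_coeff_ne_zero ?_ ?_
  · refine (natDegree_sub_le _ _).trans (max_le ?_ ?_)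
    · exact (natDegree_jostPoly_le A B a b n).trans (by lia)
    · refine (natDegree_C_mul_le _ _).trans (natDegree_mul_le.trans ?_)
      have h3 := natDegree_joukowskyLift_le a b n (recPoly A B n)
      rw [natDegree_X]
      lia
  · have h0 : (jostPoly A B a b n).coeff (2 * n + 1) = 0 :=
      coeff_eq_zero_of_natDegree_lt ((natDegree_jostPoly_le A B a b n).trans_lt (by lia))
    have := coeff_recPoly_pos B hA n
    have h4 := sub_ne_zero.2 hB
    rw [coeff_sub, h0, coeff_C_mul, coeff_X_mul, coeff_two_mul_joukowskyLift]
    simp only [zero_sub, ne_eq, neg_eq_zero]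
    positivity

theorem ne_zero_of_aeval_eq_zero {f : ℝ[X]} (hf : f.eval 0 ≠ 0) {z : ℂ} (hz : aeval z f = 0) :
    z ≠ 0 := by
  rintro rfl
  rw [← Complex.ofReal_zero, aeval_ofReal_complex] at hz
  exact hf (by exact_mod_cast hz)

/-- At a zero of `ψ̂_n`, the product of `a_n p_{n-1}` with the derivative of `ψ_n` is negative. -/
theorem prevTerm_mul_derivative_jostPoly_neg {A : ℕ → ℝ} (B : ℕ → ℝ)
    (hA : ∀ n, 1 ≤ n → 0 < A n) {a : ℝ} (ha : 0 < a) (b : ℝ) (n : ℕ) {z : ℝ} (hz : z ≠ 0)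
    (hz1 : |z| ≤ 1) (h : (jostPoly A B a b n).eval z = 0) :
    ∃ d : ℝ, (derivative (jostPoly A B a b n)).eval z = z ^ n * d ∧
      (prevTerm A B n).eval (a * (z + 1 / z) + b) * d < 0 := by
  set x := a * (z + 1 / z) + b with hx
  set p := recPoly A B n
  set T := prevTerm A B n
  have hψ : p.eval x = z / a * T.eval x := by
    have := eval_jostPoly B hA ha b n hz
    rw [h, eq_comm, mul_eq_zero, or_iff_right (pow_ne_zero _ hz), sub_eq_zero] at this
    exact this
  have hT : T.eval x ≠ 0 := by
    intro h0
    have h1 : p.eval x = 0 := by rw [hψ, h0, mul_zero]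
    refine aeval_prevTerm_ne_zero B hA (x : ℂ) n ?_ ?_ <;> rw [aeval_ofReal_complex]
    · exact_mod_cast h1
    · exact_mod_cast h0
  have hxd : HasDerivAt (fun t : ℝ => a * (t + 1 / t) + b) (a * (1 - 1 / z ^ 2)) z := by
    have h1 : HasDerivAt (fun t : ℝ => 1 / t) (-1 / z ^ 2) z := by
      simpa [neg_div] using hasDerivAt_inv hz
    exact ((((hasDerivAt_id z).add h1).const_mul a).add_const b).congr_deriv (by ring)
  set d := (derivative p).eval x * (a * (1 - 1 / z ^ 2)) -
    (1 / a * T.eval x + z / a * ((derivative T).eval x * (a * (1 - 1 / z ^ 2)))) with hd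
  have hψd : HasDerivAt (fun t : ℝ => p.eval (a * (t + 1 / t) + b) -
      t / a * T.eval (a * (t + 1 / t) + b)) d z := by
    have hp := (p.hasDerivAt x).comp z hxd
    have hT := (T.hasDerivAt x).comp z hxd
    exact hp.sub (((hasDerivAt_id z).div_const a).mul hT)
  refine ⟨d, ?_, ?_⟩
  · have h1 := (((hasDerivAt_id z).pow n).mul hψd)
    have h2 : HasDerivAt (fun t : ℝ => (jostPoly A B a b n).eval t)
        ((derivative (jostPoly A B a b n)).eval z) z := Polynomial.hasDerivAt _ _
    have h3 := h2.congr_of_eventuallyEq (f₁ := fun t : ℝ => t ^ n * (p.eval (a * (t + 1 / t) + b) -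
      t / a * T.eval (a * (t + 1 / t) + b))) (by
        filter_upwards [isOpen_ne.mem_nhds hz] with t ht
        exact (eval_jostPoly B hA ha b n ht).symm)
    have h4 := h3.unique h1
    rw [h4, ← hx, hψ]
    simp
  · have hS := congrArg (fun q => q.eval x) (sum_sq_recPoly B hA n)
    simp only [eval_sub, eval_mul, eval_finsetSum, eval_pow] at hS
    have hS0 : 0 ≤ ∑ k ∈ Finset.range n, (recPoly A B k).eval x ^ 2 :=
      Finset.sum_nonneg fun _ _ => sq_nonneg _
    -- The zero condition p = (z/a) T turns T d into x'(z) (p' T - p T') - T²/a. The bracket is the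
    -- sum of squares of the confluent formula, and x'(z) = a(1 - 1/z²) ≤ 0 for |z| ≤ 1.
    have heq : T.eval x * d = a * (1 - 1 / z ^ 2) *
        (∑ k ∈ Finset.range n, (recPoly A B k).eval x ^ 2) - T.eval x ^ 2 / a := by
      rw [hS, hψ, hd]
      ring
    have hz2 : 1 ≤ 1 / z ^ 2 := by
      rw [le_div_iff₀ (by positivity), one_mul, ← sq_abs]
      exact pow_le_one₀ (abs_nonneg z) hz1
    have h5 : a * (1 - 1 / z ^ 2) * (∑ k ∈ Finset.range n, (recPoly A B k).eval x ^ 2) ≤ 0 :=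
      mul_nonpos_of_nonpos_of_nonneg
        (mul_nonpos_of_nonneg_of_nonpos ha.le (by linarith)) hS0
    have h6 : 0 < T.eval x ^ 2 / a := by positivity
    linarith

/-- With T = a_n p_{n-1}, a zero satisfies p_n = (z/a) T and T ≠ 0. Christoffel–Darboux reads Im x ·
∑|p_k|² = Im z · |T|²/a. If Im z ≠ 0, dividing by it makes the left side nonpositive and the right
side positive, since Im x = Im z · a(1 - 1/|z|²). A common zero of f(z) and f(1/z) would give z T =
T/z, so z² = 1. -/
theorem hasJostZeros_jostPoly {A : ℕ → ℝ} (B : ℕ → ℝ) (hA : ∀ n, 1 ≤ n → 0 < A n) {a : ℝ}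
    (ha : 0 < a) (b : ℝ) (n : ℕ) : HasJostZeros (jostPoly A B a b n) := by
  have h0 : 0 < (jostPoly A B a b n).eval 0 := by
    rw [eval_zero_jostPoly B hA]
    have := coeff_recPoly_pos B hA n
    positivity
  have ha' : (a : ℂ) ≠ 0 := by exact_mod_cast ha.ne'
  have hψ {z : ℂ} (hz : aeval z (jostPoly A B a b n) = 0) :
      aeval (xOf a b z) (recPoly A B n) = z / a * aeval (xOf a b z) (prevTerm A B n) := by
    have hz0 := ne_zero_of_aeval_eq_zero h0.ne' hz
    rwa [aeval_jostPoly B hA ha b n hz0, mul_eq_zero, or_iff_right (pow_ne_zero _ hz0),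
      sub_eq_zero] at hz
  have hreal : ∀ z : ℂ, ‖z‖ ≤ 1 → aeval z (jostPoly A B a b n) = 0 → z.im = 0 := by
    intro z hz1 hz
    have hz0 := ne_zero_of_aeval_eq_zero h0.ne' hz
    have hp := hψ hz
    by_contra him
    have hCD := im_mul_sum_sq_norm_recPoly B hA (xOf a b z) n
    set T := aeval (xOf a b z) (prevTerm A B n) with hTdef
    have hT : T ≠ 0 := fun hT0 => aeval_prevTerm_ne_zero B hA (xOf a b z) n
      (by rw [hp, hT0, mul_zero]) hT0
    rw [hp, mul_assoc, Complex.mul_conj, Complex.im_mul_ofReal, Complex.div_ofReal_im] at hCD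
    have hx : (xOf a b z).im = z.im * (a * (1 - 1 / Complex.normSq z)) := by
      simp [xOf]
      ring
    have hN : 0 < Complex.normSq z := Complex.normSq_pos.2 hz0
    have hN1 : 1 ≤ 1 / Complex.normSq z := by
      rw [le_div_iff₀ hN, one_mul, Complex.normSq_eq_norm_sq]
      exact pow_le_one₀ (norm_nonneg z) hz1
    rw [hx, div_mul_eq_mul_div, mul_assoc, mul_div_assoc, mul_right_inj' him] at hCD
    have h5 : 0 < Complex.normSq T / a := div_pos (Complex.normSq_pos.2 hT) ha
    have h6 : 0 ≤ ∑ k ∈ Finset.range n, Complex.normSq (aeval (xOf a b z) (recPoly A B k)) :=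
      Finset.sum_nonneg fun _ _ => Complex.normSq_nonneg _
    have h7 : a * (1 - 1 / Complex.normSq z) *
        ∑ k ∈ Finset.range n, Complex.normSq (aeval (xOf a b z) (recPoly A B k)) ≤ 0 :=
      mul_nonpos_of_nonpos_of_nonneg (mul_nonpos_of_nonneg_of_nonpos ha.le (by linarith)) h6
    linarith
  refine ⟨h0, hreal, ?_, ?_⟩
  · intro z hz1 hz hd
    have hz0 := ne_zero_of_aeval_eq_zero h0.ne' hz
    obtain ⟨r, rfl⟩ : ∃ r : ℝ, z = r := ⟨z.re, by
      apply Complex.ext <;> simp [hreal z hz1 hz]⟩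
    rw [aeval_ofReal_complex] at hz hd
    have hr0 : r ≠ 0 := by exact_mod_cast hz0
    obtain ⟨d, hd1, hd2⟩ := prevTerm_mul_derivative_jostPoly_neg B hA ha b n hr0
      (by simpa using hz1) (by exact_mod_cast hz)
    have hd0 : d = 0 := by
      have : r ^ n * d = 0 := by rw [← hd1]; exact_mod_cast hd
      exact (mul_eq_zero.1 this).resolve_left (pow_ne_zero _ hr0)
    rw [hd0, mul_zero] at hd2
    exact hd2.false
  · intro z hz0 hz1 hzm hz hz'
    have h1 := hψ hz
    have h2 := hψ hz'
    rw [xOf_one_div, h1] at h2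
    have hT : aeval (xOf a b z) (prevTerm A B n) ≠ 0 := fun hT0 =>
      aeval_prevTerm_ne_zero B hA (xOf a b z) n (by rw [h1, hT0, mul_zero]) hT0
    have h3 := mul_right_cancel₀ hT h2
    field_simp at h3
    rcases sq_eq_one_iff.1 h3 with h | h
    · exact hz1 h
    · exact hzm h

/-- If the coefficients are constant from `n₀` on, so are the functions `z ^ n ψ_n (z)`. -/
theorem jostPoly_eq_of_le {A B : ℕ → ℝ} {a b : ℝ} (ha : 0 < a) {n₀ : ℕ}
    (h : ∀ n, n₀ ≤ n → A (n + 1) = a ∧ B n = b) {n : ℕ} (hn : n₀ ≤ n) :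
    jostPoly A B a b n = jostPoly A B a b n₀ := by
  induction n, hn using Nat.le_induction with
  | base => rfl
  | succ n hn ih =>
    rw [jostPoly, (h n hn).1, (h n hn).2, div_self ha.ne', div_self (by positivity), ih]
    simp

/-- The closed form of ψ̂_n is used at z and at 1/z, which share the same x; the combination
eliminates `prevTerm`. -/
theorem sub_mul_aeval_recPoly {A : ℕ → ℝ} (B : ℕ → ℝ) (hA : ∀ n, 1 ≤ n → 0 < A n) {a : ℝ}
    (ha : 0 < a) (b : ℝ) (n : ℕ) {z : ℂ} (hz : z ≠ 0) :
    (z - 1 / z) * aeval (xOf a b z) (recPoly A B n) =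
      z ^ (n + 1) * aeval (1 / z) (jostPoly A B a b n) -
        (1 / z) ^ (n + 1) * aeval z (jostPoly A B a b n) := by
  rw [aeval_jostPoly B hA ha b n hz, aeval_jostPoly B hA ha b n (one_div_ne_zero hz), xOf_one_div]
  have ha' : (a : ℂ) ≠ 0 := by exact_mod_cast ha.ne'
  simp only [div_pow, one_pow]
  field_simp
  ring

theorem aeval_recPoly_of_aeval_jostPoly_eq_zero {A : ℕ → ℝ} {B : ℕ → ℝ}
    (hA : ∀ n, 1 ≤ n → 0 < A n) {a : ℝ} (ha : 0 < a) {b : ℝ} {n₀ : ℕ}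
    (h : ∀ n, n₀ ≤ n → A (n + 1) = a ∧ B n = b) {z : ℂ}
    (hz : aeval z (jostPoly A B a b n₀) = 0) (hz1 : z ≠ 1) (hzm : z ≠ -1) {n : ℕ} (hn : n₀ ≤ n) :
    aeval (xOf a b z) (recPoly A B n) =
      z ^ (n + 1) * aeval (1 / z) (jostPoly A B a b n₀) / (z - 1 / z) := by
  have hz0 := ne_zero_of_aeval_eq_zero (hasJostZeros_jostPoly B hA ha b n₀).eval_zero_pos.ne' hz
  have h1 := sub_mul_aeval_recPoly B hA ha b n hz0
  rw [jostPoly_eq_of_le ha h hn, hz, mul_zero, sub_zero] at h1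
  have h2 : z - 1 / z ≠ 0 := by
    intro h2
    field_simp at h2
    rcases sq_eq_one_iff.1 (sub_eq_zero.1 (h2.trans (mul_zero z))) with h | h
    · exact hz1 h
    · exact hzm h
  rw [eq_div_iff h2, ← h1, mul_comm]

theorem exists_norm_aeval_recPoly_le {A : ℕ → ℝ} {B : ℕ → ℝ}
    (hA : ∀ n, 1 ≤ n → 0 < A n) {a : ℝ} (ha : 0 < a) {b : ℝ} {n₀ : ℕ}
    (h : ∀ n, n₀ ≤ n → A (n + 1) = a ∧ B n = b) {z : ℂ}
    (hz : aeval z (jostPoly A B a b n₀) = 0) (hz1 : ‖z‖ < 1) :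
    ∃ K : ℝ, ∀ n, ‖aeval (xOf a b z) (recPoly A B n)‖ ≤ K * ‖z‖ ^ n := by
  have hz0 := ne_zero_of_aeval_eq_zero (hasJostZeros_jostPoly B hA ha b n₀).eval_zero_pos.ne' hz
  have hn0 : 0 < ‖z‖ := norm_pos_iff.2 hz0
  -- For n ≥ n₀ the ratio |p_n(x)| / |z|^n is exactly K₁; the finitely many earlier ratios are
  -- absorbed by adding their sum.
  set K₁ := ‖z‖ * ‖aeval (1 / z) (jostPoly A B a b n₀)‖ / ‖z - 1 / z‖ with hK₁
  set g : ℕ → ℝ := fun k => ‖aeval (xOf a b z) (recPoly A B k)‖ / ‖z‖ ^ k with hg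
  have hS : 0 ≤ ∑ k ∈ Finset.range n₀, g k := Finset.sum_nonneg fun k _ => by positivity
  have hK0 : 0 ≤ K₁ := by positivity
  refine ⟨K₁ + ∑ k ∈ Finset.range n₀, g k, fun n => ?_⟩
  rw [← div_le_iff₀ (by positivity)]
  rcases le_or_gt n₀ n with hn | hn
  · have h1 : z ≠ 1 := by rintro rfl; simp at hz1
    have h2 : z ≠ -1 := by rintro rfl; simp at hz1
    rw [aeval_recPoly_of_aeval_jostPoly_eq_zero hA ha h hz h1 h2 hn]
    have : ‖z ^ (n + 1) * aeval (1 / z) (jostPoly A B a b n₀) / (z - 1 / z)‖ / ‖z‖ ^ n = K₁ := by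
      rw [norm_div, norm_mul, norm_pow, hK₁, pow_succ]
      field_simp
    linarith
  · have := Finset.single_le_sum (f := g) (fun k _ => by positivity) (Finset.mem_range.2 hn)
    exact this.trans (by linarith)

/-! ### The canonical masses -/

/-- The radicand is the square of (1/z - z)/2, and x - b has the sign of z, which selects the branch
equal to z. That sign is locally constant, so the branch can be differentiated, giving the
reciprocal of x'(z). -/
theorem zOf_eq_and_hasDerivAt {a : ℝ} (ha : 0 < a) (b : ℝ) {z : ℝ} (hz : z ≠ 0) (hz1 : |z| < 1) :
    zOf a b (a * (z + 1 / z) + b) = z ∧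
      HasDerivAt (zOf a b) (1 / (a * (1 - 1 / z ^ 2))) (a * (z + 1 / z) + b) := by
  set x := a * (z + 1 / z) + b with hx
  have hzz : z ^ 2 < 1 := (sq_lt_one_iff_abs_lt_one z).2 hz1
  have ht : (x - b) / (2 * a) = (z + 1 / z) / 2 := by rw [hx]; field_simp; ring
  have hrad : ((x - b) / (2 * a)) ^ 2 - 1 = ((1 / z - z) / 2) ^ 2 := by
    rw [ht]; field_simp; ring
  have hne : 1 / z - z ≠ 0 := by
    intro h
    field_simp at h
    linarith
  have hrad0 : ((x - b) / (2 * a)) ^ 2 - 1 ≠ 0 := by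
    rw [hrad]
    positivity
  have hd1 : HasDerivAt (fun y : ℝ => (y - b) / (2 * a)) (1 / (2 * a)) x :=
    ((hasDerivAt_id x).sub_const b).div_const (2 * a)
  have hd2 := ((hd1.pow 2).sub_const 1).sqrt hrad0
  have hz2 : 1 - 1 / z ^ 2 ≠ 0 := by
    intro h
    field_simp at h
    linarith
  rcases hz.lt_or_gt with hneg | hpos
  · have hsqrt : √(((x - b) / (2 * a)) ^ 2 - 1) = (z - 1 / z) / 2 := by
      rw [hrad, Real.sqrt_sq_eq_abs, abs_div, abs_two, abs_of_neg]
      · ring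
      · rw [sub_neg, div_lt_iff_of_neg hneg]
        linarith [sq z]
    have hxb : x - b < 0 := by
      have : 1 / z < 0 := one_div_neg.2 hneg
      rw [hx, add_sub_cancel_right]
      exact mul_neg_of_pos_of_neg ha (by linarith)
    constructor
    · rw [zOf, if_neg (not_le.2 hxb), hsqrt, ht]
      ring
    · refine ((hd1.add hd2).congr_deriv ?_).congr_of_eventuallyEq ?_
      · simp only [Pi.pow_apply]
        rw [hsqrt, ht]
        have : z - 1 / z ≠ 0 := fun h => hne (by linarith)
        have h3 : z ^ 2 - 1 ≠ 0 := by linarith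
        have h4 : 1 - z ^ 2 ≠ 0 := by linarith
        rw [show 2 - 1 = 1 from rfl, pow_one, Nat.cast_ofNat]
        field_simp
        ring
      · filter_upwards [(isOpen_Iio (a := b)).mem_nhds (show x < b by linarith)] with y hy
        rw [zOf, if_neg (not_le.2 (sub_neg.2 hy))]
        rfl
  · have hsqrt : √(((x - b) / (2 * a)) ^ 2 - 1) = (1 / z - z) / 2 := by
      rw [hrad, Real.sqrt_sq]
      have : z ≤ 1 / z := by
        rw [le_div_iff₀ hpos]
        linarith [sq z]
      linarith
    have hxb : 0 < x - b := by
      rw [hx, add_sub_cancel_right]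
      positivity
    constructor
    · rw [zOf, if_pos hxb.le, hsqrt, ht]
      ring
    · refine ((hd1.sub hd2).congr_deriv ?_).congr_of_eventuallyEq ?_
      · simp only [Pi.pow_apply]
        rw [hsqrt, ht]
        have h3 : z ^ 2 - 1 ≠ 0 := by linarith
        have h4 : 1 - z ^ 2 ≠ 0 := by linarith
        rw [show 2 - 1 = 1 from rfl, pow_one, Nat.cast_ofNat]
        field_simp
        ring
      · filter_upwards [(isOpen_Ioi (a := b)).mem_nhds (show b < x by linarith)] with y hy
        rw [zOf, if_pos (sub_pos.2 hy).le]
        rfl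

/-- Since f(z) = 0, only one term of the product rule survives, and the chain rule contributes
1/x'(z). -/
theorem canonicalMass_eq {a : ℝ} (ha : 0 < a) (b : ℝ) (f : ℝ[X]) {z : ℝ} (hz : z ≠ 0)
    (hz1 : |z| < 1) (hf : f.eval z = 0) : canonicalMass a b f z =
      (z - 1 / z) * (1 - 1 / z ^ 2) / ((derivative f).eval z * f.eval (1 / z)) := by
  obtain ⟨h1, h2⟩ := zOf_eq_and_hasDerivAt ha b hz hz1
  have h3 := (f.hasDerivAt _).comp _ h2
  have h4 := h2.inv (by rwa [h1])
  have h5 := (f.hasDerivAt _).comp _ h4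
  have h6 := h3.mul h5
  simp only [Function.comp_apply, Pi.inv_apply, h1, hf, zero_mul, add_zero] at h6
  have h7 : deriv (fun x : ℝ => f.eval (zOf a b x) * f.eval (1 / zOf a b x))
      (a * (z + 1 / z) + b) = (derivative f).eval z * (1 / (a * (1 - 1 / z ^ 2))) *
        f.eval z⁻¹ := by
    rw [← h6.deriv]
    congr 1
    funext x
    simp
  have hzz : z ^ 2 < 1 := (sq_lt_one_iff_abs_lt_one z).2 hz1
  have hz2 : 1 - 1 / z ^ 2 ≠ 0 := by
    intro h
    field_simp at h
    linarith
  rw [canonicalMass, h7, one_div z]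
  -- When the denominator vanishes, both sides are 0 by the convention for division by zero.
  rcases eq_or_ne ((derivative f).eval z * f.eval z⁻¹) 0 with h0 | h0
  · rw [h0, mul_right_comm, h0]
    simp
  · have h8 := left_ne_zero_of_mul h0
    have h9 := right_ne_zero_of_mul h0
    generalize 1 - 1 / z ^ 2 = s at *
    field_simp

theorem mem_diskZeros {f : ℝ[X]} (hf : f.eval 0 ≠ 0) {z : ℝ} :
    z ∈ diskZeros f ↔ f.eval z = 0 ∧ |z| < 1 := by
  have : f ≠ 0 := by rintro rfl; simp at hf
  simp [diskZeros, this]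

theorem ne_zero_of_eval_eq_zero {f : ℝ[X]} (hf : f.eval 0 ≠ 0) {z : ℝ} (hz : f.eval z = 0) :
    z ≠ 0 := by
  rintro rfl
  exact hf hz

/-- Inserting p_n = (z/a) T into the value at 1/z reduces the mass to a(1 - 1/z²) / (T d), a
quotient of two negative numbers. -/
theorem canonicalMass_jostPoly_pos {A : ℕ → ℝ} (B : ℕ → ℝ) (hA : ∀ n, 1 ≤ n → 0 < A n) {a : ℝ}
    (ha : 0 < a) (b : ℝ) (n : ℕ) : ∀ z ∈ diskZeros (jostPoly A B a b n),
      0 < canonicalMass a b (jostPoly A B a b n) z := by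
  intro z hz
  have h0 := (hasJostZeros_jostPoly B hA ha b n).eval_zero_pos.ne'
  obtain ⟨hf, hz1⟩ := (mem_diskZeros h0).1 hz
  have hz0 := ne_zero_of_eval_eq_zero h0 hf
  rw [canonicalMass_eq ha b _ hz0 hz1 hf]
  obtain ⟨d, hd, hneg⟩ := prevTerm_mul_derivative_jostPoly_neg B hA ha b n hz0 hz1.le hf
  have h1 := eval_jostPoly B hA ha b n (one_div_ne_zero hz0)
  have h2 := eval_jostPoly B hA ha b n hz0
  rw [hf, eq_comm, mul_eq_zero, or_iff_right (pow_ne_zero _ hz0), sub_eq_zero] at h2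
  rw [one_div_one_div, add_comm (1 / z), h2] at h1
  rw [hd, h1]
  set T := (prevTerm A B n).eval (a * (z + 1 / z) + b)
  have hzz : z ^ 2 < 1 := (sq_lt_one_iff_abs_lt_one z).2 hz1
  have hlt : 1 - 1 / z ^ 2 < 0 := by
    rw [sub_neg, one_lt_div (by positivity)]
    exact hzz
  have hw : z - 1 / z ≠ 0 := by
    intro h
    field_simp at h
    linarith
  have hT : T * d ≠ 0 := hneg.ne
  have hT1 := left_ne_zero_of_mul hT
  have hT2 := right_ne_zero_of_mul hT
  have : (z - 1 / z) * (1 - 1 / z ^ 2) / (z ^ n * d * ((1 / z) ^ n * (z / a * T - 1 / z / a * T))) =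
      a * (1 - 1 / z ^ 2) / (T * d) := by
    have e : z ^ n * d * ((1 / z) ^ n * (z / a * T - 1 / z / a * T)) =
        (T * d) * (z - 1 / z) / a := by
      rw [one_div_pow]
      have : z ^ n ≠ 0 := pow_ne_zero _ hz0
      field_simp
    rw [e]
    generalize 1 - 1 / z ^ 2 = s
    generalize z - 1 / z = w at *
    field_simp
  rw [this]
  exact div_pos_of_neg_of_neg (mul_neg_of_pos_of_neg ha hlt) hneg

/-! ### Circle averages of rational functions -/

/-- The residues of 1/(z(z - w)) at 0 and w cancel. Concretely, 1/(z - w) = (z/(z - w) - 1)/w, and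
z/(z - w) has average 1 by Cauchy's formula. -/
theorem circleAverage_inv_sub {w : ℂ} (hw : ‖w‖ < 1) (hw0 : w ≠ 0) :
    Real.circleAverage (fun z => (z - w)⁻¹) 0 1 = 0 := by
  have h1 : Real.circleAverage (fun z : ℂ => ((z - 0) / (z - w)) • (1 : ℂ)) 0 1 = 1 :=
    circleAverage_sub_sub_inv_smul_of_differentiable_on_off_countable (f := fun _ => (1 : ℂ))
      Set.countable_empty continuousOn_const (fun _ _ => differentiableAt_const _) (by simpa)
  have hne : ∀ z ∈ Metric.sphere (0 : ℂ) |1|, z - w ≠ 0 := by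
    intro z hz h
    rw [abs_one, mem_sphere_zero_iff_norm, sub_eq_zero.1 h] at hz
    exact hw.ne hz
  have hcont : ContinuousOn (fun z : ℂ => w⁻¹ • (((z - 0) / (z - w)) • (1 : ℂ)))
      (Metric.sphere 0 |1|) := by
    have h3 : ContinuousOn (fun z : ℂ => (z - 0) / (z - w)) (Metric.sphere 0 |1|) :=
      ContinuousOn.div (by fun_prop) (by fun_prop) hne
    exact (ContinuousOn.smul h3 (continuousOn_const (c := (1 : ℂ)))).const_smul w⁻¹
  have h2 : Real.circleAverage (fun z : ℂ => w⁻¹ • (((z - 0) / (z - w)) • (1 : ℂ)) - w⁻¹) 0 1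
      = 0 := by
    rw [Real.circleAverage_fun_sub (hcont.circleIntegrable') (circleIntegrable_const _ _ _),
      Real.circleAverage_fun_smul, h1, Real.circleAverage_const]
    simp
  refine Eq.trans ?_ h2
  refine Real.circleAverage_congr_sphere fun z hz => ?_
  have := hne z hz
  simp only [sub_zero, smul_eq_mul, mul_one]
  field_simp
  ring

/-- If the zeros of `F` in the closed unit disk are simple and `N` vanishes at those on the unit
circle, then `N / F` extends continuously to the circle, and its average is the sum of the residues
of `N / (z F)`. -/
theorem exists_continuousOn_circleAverage_eq (F N : ℂ[X]) (Z : Finset ℂ)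
    (hZ : ∀ z, z ∈ Z ↔ ‖z‖ ≤ 1 ∧ F.eval z = 0)
    (hsimple : ∀ z ∈ Z, (derivative F).eval z ≠ 0) (h0 : F.eval 0 ≠ 0)
    (hN : ∀ z ∈ Z, ‖z‖ = 1 → N.eval z = 0) :
    ∃ g : ℂ → ℂ, ContinuousOn g (Metric.sphere 0 1) ∧
      (∀ z ∈ Metric.sphere (0 : ℂ) 1, N.eval z = g z * F.eval z) ∧
      Real.circleAverage g 0 1 = N.eval 0 / F.eval 0 +
        ∑ w ∈ Z.filter (fun w => ‖w‖ < 1), N.eval w / (w * (derivative F).eval w) := by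
  have hcop (S : Finset ℂ) : (S : Set ℂ).Pairwise
      (Function.onFun IsCoprime fun w : ℂ => (X - C w : ℂ[X])) := fun v _ w _ hvw =>
    isCoprime_X_sub_C_of_isUnit_sub (sub_ne_zero.2 hvw).isUnit
  -- F is split into its zeros in the closed disk and a cofactor h; simplicity of the zeros makes h
  -- zero-free there.
  obtain ⟨h, hF⟩ : (∏ w ∈ Z, (X - C w)) ∣ F :=
    Finset.prod_dvd_of_coprime (hcop Z) fun w hw => dvd_iff_isRoot.2 ((hZ w).1 hw).2
  set E : ℂ → ℂ[X] := fun w => ∏ v ∈ Z.erase w, (X - C v) with hE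
  have hWE {w : ℂ} (hw : w ∈ Z) : ∏ v ∈ Z, (X - C v) = (X - C w) * E w :=
    (Finset.mul_prod_erase Z (fun v => X - C v) hw).symm
  have hF' {w : ℂ} (hw : w ∈ Z) : (derivative F).eval w = (E w).eval w * h.eval w := by
    rw [hF, hWE hw, mul_assoc, derivative_mul, derivative_X_sub_C]
    simp
  have hh : ∀ z, ‖z‖ ≤ 1 → h.eval z ≠ 0 := by
    intro z hz hz0
    have hzZ : z ∈ Z := (hZ z).2 ⟨hz, by rw [hF, eval_mul, hz0, mul_zero]⟩
    exact hsimple z hzZ (by rw [hF' hzZ, hz0, mul_zero])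
  set c : ℂ → ℂ := fun w => N.eval w / (derivative F).eval w with hc
  have hEne {w v : ℂ} (hv : v ∈ Z) (hwv : w ≠ v) : (E w).eval v = 0 := by
    rw [hE, eval_prod]
    exact Finset.prod_eq_zero (Finset.mem_erase.2 ⟨hwv.symm, hv⟩) (by simp)
  -- Lagrange interpolation: with c_w = N(w)/F'(w) the difference vanishes on Z, whence the partial
  -- fractions N/F = P/h + ∑ c_w/(z - w) with P/h analytic on the closed disk.
  obtain ⟨P, hP⟩ : (∏ w ∈ Z, (X - C w)) ∣ N - h * ∑ w ∈ Z, C (c w) * E w := by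
    refine Finset.prod_dvd_of_coprime (hcop Z) fun v hv => dvd_iff_isRoot.2 ?_
    rw [IsRoot.def, eval_sub, eval_mul, eval_finsetSum, Finset.sum_eq_single_of_mem v hv]
    · have := hsimple v hv
      rw [eval_mul, eval_C, hc, mul_left_comm, mul_comm (h.eval v), ← hF' hv,
        div_mul_cancel₀ _ this, sub_self]
    · intro w _ hwv
      rw [eval_mul, hEne hv hwv, mul_zero]
  set Zi := Z.filter (fun w => ‖w‖ < 1) with hZi
  -- The zeros on the unit circle have c_w = 0 and drop out, so the partial fraction sum has no pole
  -- on the circle.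
  have hsum {u : ℂ → ℂ} : ∑ w ∈ Z, c w * u w = ∑ w ∈ Zi, c w * u w := by
    refine (Finset.sum_filter_of_ne fun w hw hne => ?_).symm
    refine lt_of_le_of_ne ((hZ w).1 hw).1 fun h1 => hne ?_
    rw [hc]
    simp [hN w hw h1]
  set g : ℂ → ℂ := fun z => P.eval z / h.eval z + ∑ w ∈ Zi, c w * (z - w)⁻¹ with hg
  have hgF {z : ℂ} (hz : ‖z‖ ≤ 1) (hzZ : z ∉ Z) : N.eval z = g z * F.eval z := by
    have hW : ∀ w ∈ Z, (∏ v ∈ Z, (X - C v)).eval z * (z - w)⁻¹ = (E w).eval z := by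
      intro w hw
      have : z - w ≠ 0 := sub_ne_zero.2 fun h => hzZ (h ▸ hw)
      rw [hWE hw, eval_mul, eval_sub, eval_X, eval_C]
      field_simp
    have h1 := congrArg (fun p => p.eval z) hP
    simp only [eval_sub, eval_mul, eval_finsetSum, eval_C] at h1
    rw [sub_eq_iff_eq_add] at h1
    simp only [hg]
    rw [h1, ← hsum (u := fun w => (z - w)⁻¹), hF, eval_mul, add_mul]
    have := hh z hz
    congr 1
    · field_simp
    · rw [Finset.mul_sum, Finset.sum_mul]
      refine Finset.sum_congr rfl fun w hw => ?_
      rw [← hW w hw]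
      ring
  have hne : ∀ w ∈ Zi, ∀ z ∈ Metric.sphere (0 : ℂ) |1|, z - w ≠ 0 := by
    intro w hw z hz h1
    rw [abs_one, mem_sphere_zero_iff_norm, sub_eq_zero.1 h1] at hz
    exact (Finset.mem_filter.1 hw).2.ne hz
  have hPh : ∀ z, ‖z‖ ≤ 1 → DifferentiableAt ℂ (fun z => P.eval z / h.eval z) z := fun z hz =>
    P.differentiable.differentiableAt.div h.differentiable.differentiableAt (hh z hz)
  have hc1 : ContinuousOn (fun z => P.eval z / h.eval z) (Metric.closedBall 0 |1|) := fun z hz =>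
    (hPh z (by simpa using hz)).continuousAt.continuousWithinAt
  have hc2 : ∀ w ∈ Zi, ContinuousOn (fun z => c w * (z - w)⁻¹) (Metric.sphere 0 |1|) :=
    fun w hw => ContinuousOn.mul continuousOn_const
      ((continuousOn_id.sub continuousOn_const).inv₀ (hne w hw))
  have hc3 := hc1.mono Metric.sphere_subset_closedBall
  have hgc : ContinuousOn g (Metric.sphere 0 |1|) := hc3.add (continuousOn_finsetSum _ hc2)
  have h0Z : (0 : ℂ) ∉ Z := fun h => h0 ((hZ 0).1 h).2
  refine ⟨g, ?_, ?_, ?_⟩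
  · simpa using hgc
  · intro z hz
    have hz1 : ‖z‖ = 1 := by simpa using hz
    by_cases hzZ : z ∈ Z
    · rw [hN z hzZ hz1, ((hZ z).1 hzZ).2, mul_zero]
    · simpa using hgF hz1.le hzZ
  · rw [hg, Real.circleAverage_fun_add hc3.circleIntegrable'
      (continuousOn_finsetSum _ hc2).circleIntegrable',
      Real.circleAverage_fun_sum fun w hw => (hc2 w hw).circleIntegrable',
      circleAverage_of_differentiable_on_off_countable Set.countable_empty hc1
        (fun z hz => hPh z (by simpa using (Metric.mem_ball.1 hz.1).le))]
    -- The average equals P(0)/h(0), because each 1/(z - w) averages to 0. Evaluating the partial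
    -- fractions at 0 gives P(0)/h(0) = N(0)/F(0) + ∑ c_w/w.
    have h2 := hgF (z := 0) (by simp) h0Z
    rw [h2, mul_div_cancel_right₀ _ h0, hg, Finset.sum_eq_zero, add_zero]
    · simp only [zero_sub]
      rw [add_assoc, ← Finset.sum_add_distrib, Finset.sum_eq_zero, add_zero]
      intro w hw
      have hw0 : w ≠ 0 := fun h => h0Z (h ▸ (Finset.mem_filter.1 hw).1)
      have := hsimple w (Finset.mem_filter.1 hw).1
      rw [hc]
      field_simp
      ring
    · intro w hw
      have hw0 : w ≠ 0 := fun h => h0Z (h ▸ (Finset.mem_filter.1 hw).1)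
      have h3 := Real.circleAverage_fun_smul (𝕜 := ℂ) (a := c w) (f := fun z => (z - w)⁻¹) (c := 0)
        (R := 1)
      simp only [smul_eq_mul] at h3
      rw [h3, circleAverage_inv_sub (Finset.mem_filter.1 hw).2 hw0, mul_zero]

/-! ### Integration over the absolutely continuous part -/

/-- The absolutely continuous part of the Bernstein–Szegő measure. -/
def bsContinuousPart (a b : ℝ) (f : ℝ[X]) : Measure ℝ :=
  (volume.restrict (Set.Ioo (b - 2 * a) (b + 2 * a))).withDensity
    (fun x => ENNReal.ofReal (bsDensity a f (Real.arccos ((x - b) / (2 * a)))))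

/-- The sum of the point masses of the Bernstein–Szegő measure. -/
def bsPointMasses (a b : ℝ) (f : ℝ[X]) : Measure ℝ :=
  ∑ z ∈ diskZeros f, ENNReal.ofReal (canonicalMass a b f z) • Measure.dirac (a * (z + 1 / z) + b)

theorem measurable_bsDensity (a : ℝ) (f : ℝ[X]) : Measurable (bsDensity a f) := by
  unfold bsDensity
  have h1 : Continuous fun θ : ℝ => aeval (Complex.exp (θ * Complex.I)) f :=
    (Polynomial.continuous_aeval f).comp (by fun_prop)
  exact Real.measurable_sin.div ((h1.norm.pow 2).measurable.const_mul _)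

theorem image_cos_Ioo {a : ℝ} (ha : 0 < a) (b : ℝ) :
    (fun θ => 2 * a * Real.cos θ + b) '' Set.Ioo 0 Real.pi = Set.Ioo (b - 2 * a) (b + 2 * a) := by
  ext x
  constructor
  · rintro ⟨θ, ⟨h0, hπ⟩, rfl⟩
    have h1 : Real.cos θ < 1 := by
      have := Real.cos_lt_cos_of_nonneg_of_le_pi le_rfl hπ.le h0
      rwa [Real.cos_zero] at this
    have h2 : -1 < Real.cos θ := by
      have := Real.cos_lt_cos_of_nonneg_of_le_pi h0.le le_rfl hπ
      rwa [Real.cos_pi] at this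
    constructor <;> simp only <;> nlinarith
  · rintro ⟨h1, h2⟩
    have h3 : -1 < (x - b) / (2 * a) := by rw [lt_div_iff₀ (by positivity)]; linarith
    have h4 : (x - b) / (2 * a) < 1 := by rw [div_lt_iff₀ (by positivity)]; linarith
    refine ⟨Real.arccos ((x - b) / (2 * a)), ⟨Real.arccos_pos.2 h4, ?_⟩, ?_⟩
    · exact Real.arccos_lt_pi.2 h3
    · simp only
      rw [Real.cos_arccos h3.le h4.le]
      field_simp
      ring

theorem bsDensity_nonneg {a : ℝ} (ha : 0 < a) (f : ℝ[X]) {θ : ℝ} (hθ : 0 ≤ Real.sin θ) :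
    0 ≤ bsDensity a f θ := by
  unfold bsDensity
  have := Real.pi_pos
  positivity

theorem bsContinuousPart_integral {a : ℝ} (ha : 0 < a) (b : ℝ) (f : ℝ[X]) (g : ℝ → ℝ) :
    (Integrable g (bsContinuousPart a b f) ↔ IntegrableOn
      (fun θ => 2 * a * Real.sin θ * bsDensity a f θ * g (2 * a * Real.cos θ + b))
      (Set.Ioo 0 Real.pi)) ∧
    ∫ x, g x ∂(bsContinuousPart a b f) = ∫ θ in Set.Ioo 0 Real.pi,
      2 * a * Real.sin θ * bsDensity a f θ * g (2 * a * Real.cos θ + b) := by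
  have hmeas : Measurable fun x : ℝ =>
      ENNReal.ofReal (bsDensity a f (Real.arccos ((x - b) / (2 * a)))) := by
    refine ((measurable_bsDensity a f).comp (Real.measurable_arccos.comp ?_)).ennreal_ofReal
    fun_prop
  have hder : ∀ θ ∈ Set.Ioo 0 Real.pi, HasDerivWithinAt (fun θ => 2 * a * Real.cos θ + b)
      (2 * a * (-Real.sin θ)) (Set.Ioo 0 Real.pi) θ := fun θ _ =>
    (((Real.hasDerivAt_cos θ).const_mul (2 * a)).add_const b).hasDerivWithinAt
  have hinj : Set.InjOn (fun θ => 2 * a * Real.cos θ + b) (Set.Ioo 0 Real.pi) := by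
    intro θ hθ η hη h
    refine Real.injOn_cos (Set.Ioo_subset_Icc_self hθ) (Set.Ioo_subset_Icc_self hη) ?_
    have : 2 * a ≠ 0 := by positivity
    simpa [this] using h
  set G : ℝ → ℝ := fun x => bsDensity a f (Real.arccos ((x - b) / (2 * a))) * g x with hG
  have hsmul (x : ℝ) : (ENNReal.ofReal (bsDensity a f (Real.arccos ((x - b) / (2 * a))))).toReal •
      g x = G x := by
    rw [ENNReal.toReal_ofReal, smul_eq_mul]
    exact bsDensity_nonneg ha f (Real.sin_nonneg_of_nonneg_of_le_pi (Real.arccos_nonneg _)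
      (Real.arccos_le_pi _))
  have hcongr : Set.EqOn (fun θ => |2 * a * (-Real.sin θ)| • G (2 * a * Real.cos θ + b))
      (fun θ => 2 * a * Real.sin θ * bsDensity a f θ * g (2 * a * Real.cos θ + b))
      (Set.Ioo 0 Real.pi) := by
    intro θ hθ
    have hs := Real.sin_pos_of_pos_of_lt_pi hθ.1 hθ.2
    have h1 : (2 * a * Real.cos θ + b - b) / (2 * a) = Real.cos θ := by field_simp; ring
    simp only [hG]
    rw [h1, Real.arccos_cos hθ.1.le hθ.2.le, mul_neg, abs_neg, abs_of_pos (by positivity),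
      smul_eq_mul]
    ring
  constructor
  · rw [bsContinuousPart, integrable_withDensity_iff_integrable_smul' hmeas (by simp)]
    simp only [hsmul]
    rw [← IntegrableOn, ← image_cos_Ioo ha b,
      integrableOn_image_iff_integrableOn_abs_deriv_smul measurableSet_Ioo hder hinj]
    exact integrableOn_congr_fun hcongr measurableSet_Ioo
  · rw [bsContinuousPart, integral_withDensity_eq_integral_toReal_smul hmeas (by simp)]
    simp only [hsmul]
    rw [← image_cos_Ioo ha b, integral_image_eq_integral_abs_deriv_smul measurableSet_Ioo hder hinj]
    exact setIntegral_congr_fun measurableSet_Ioo hcongr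

/-! ### The residue computation on the unit circle -/

theorem HasJostZeros.aeval_exp_ne_zero {f : ℝ[X]} (hf : HasJostZeros f) {θ : ℝ}
    (hθ : θ ∈ Set.Ioo 0 Real.pi) : aeval (Complex.exp (θ * Complex.I)) f ≠ 0 := by
  intro h
  have h1 := hf.real_of_zero _ (Complex.norm_exp_ofReal_mul_I θ).le h
  rw [Complex.exp_ofReal_mul_I_im] at h1
  exact (Real.sin_pos_of_pos_of_lt_pi hθ.1 hθ.2).ne' h1

/-- Zeros of f on the unit circle are real, hence ±1, and are simple; the factor z² - 1 cancels
them. The function g is the continuous extension of (z² - 1) R / f to the circle. -/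
theorem HasJostZeros.exists_circleAverage_eq {f : ℝ[X]} (hf : HasJostZeros f) (R : ℝ[X]) :
    ∃ g : ℂ → ℂ, ContinuousOn g (Metric.sphere 0 1) ∧
      (∀ z ∈ Metric.sphere (0 : ℂ) 1, (z ^ 2 - 1) * aeval z R = g z * aeval z f) ∧
      Real.circleAverage g 0 1 = ((-(R.eval 0 / f.eval 0) + ∑ w ∈ diskZeros f,
        (w ^ 2 - 1) * R.eval w / (w * (derivative f).eval w) : ℝ) : ℂ) := by
  have hf0 : f ≠ 0 := by
    rintro rfl
    simpa using hf.eval_zero_pos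
  have hF (p : ℝ[X]) (z : ℂ) : (p.map (algebraMap ℝ ℂ)).eval z = aeval z p :=
    eval_map_algebraMap p z
  have hZ (z : ℂ) : z ∈ (f.roots.toFinset.filter (fun z => |z| ≤ 1)).map
      ⟨Complex.ofReal, Complex.ofReal_injective⟩ ↔
      ‖z‖ ≤ 1 ∧ (f.map (algebraMap ℝ ℂ)).eval z = 0 := by
    rw [hF]
    simp only [Finset.mem_map, Finset.mem_filter, Multiset.mem_toFinset, mem_roots hf0,
      Function.Embedding.coeFn_mk, IsRoot.def]
    constructor
    · rintro ⟨r, ⟨h1, h2⟩, rfl⟩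
      rw [aeval_ofReal_complex, h1]
      simpa using h2
    · rintro ⟨h1, h2⟩
      have h3 : z = ((z.re : ℝ) : ℂ) := by
        apply Complex.ext <;> simp [hf.real_of_zero z h1 h2]
      rw [h3, aeval_ofReal_complex] at h2
      rw [h3] at h1
      exact ⟨z.re, ⟨by exact_mod_cast h2, by simpa using h1⟩, h3.symm⟩
  obtain ⟨g, hg1, hg2, hg3⟩ := exists_continuousOn_circleAverage_eq (f.map (algebraMap ℝ ℂ))
    (((X ^ 2 - 1) * R).map (algebraMap ℝ ℂ)) _ hZ
    (by
      intro z hz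
      rw [hZ, hF] at hz
      rw [derivative_map, hF]
      exact hf.simple_of_zero z hz.1 hz.2)
    (by
      rw [hF, ← Complex.ofReal_zero, aeval_ofReal_complex]
      exact_mod_cast hf.eval_zero_pos.ne')
    (by
      intro z hz hz1
      simp only [Finset.mem_map, Function.Embedding.coeFn_mk] at hz
      obtain ⟨r, -, rfl⟩ := hz
      have : r ^ 2 = 1 := by
        rw [← sq_abs]
        simp only [Complex.norm_real, Real.norm_eq_abs] at hz1
        rw [hz1, one_pow]
      rw [hF, aeval_ofReal_complex]
      simp [this])
  refine ⟨g, hg1, fun z hz => ?_, ?_⟩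
  · have := hg2 z hz
    rw [hF, hF] at this
    simpa using this
  · rw [hg3, Finset.filter_map, Finset.sum_map, Finset.filter_filter]
    have hset : f.roots.toFinset.filter (fun w => |w| ≤ 1 ∧
        ((fun w : ℂ => ‖w‖ < 1) ∘ (⟨Complex.ofReal, Complex.ofReal_injective⟩ : ℝ ↪ ℂ)) w) =
        diskZeros f := by
      rw [diskZeros]
      refine Finset.filter_congr fun w _ => ?_
      simp only [Function.comp_apply, Function.Embedding.coeFn_mk, Complex.norm_real,
        Real.norm_eq_abs]
      exact ⟨fun h => h.2, fun h => ⟨h.le, h⟩⟩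
    rw [hset]
    simp only [Function.Embedding.coeFn_mk, derivative_map, hF]
    rw [← Complex.ofReal_zero]
    simp only [aeval_ofReal_complex]
    push_cast
    simp
    ring

/-- The lower half circle is folded onto the upper one by conjugation, which preserves the real part
of g. -/
theorem circleAverage_re_eq {g : ℂ → ℂ} (hg : ContinuousOn g (Metric.sphere 0 1))
    (hconj : ∀ θ ∈ Set.Ioo 0 Real.pi, g (starRingEnd ℂ (Complex.exp (θ * Complex.I))) =
      starRingEnd ℂ (g (Complex.exp (θ * Complex.I)))) :
    (Real.circleAverage g 0 1).re =
      Real.pi⁻¹ * ∫ θ in Set.Ioo 0 Real.pi, (g (Complex.exp (θ * Complex.I))).re := by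
  have hc : Continuous fun θ : ℝ => g (Complex.exp (θ * Complex.I)) :=
    hg.comp_continuous (by fun_prop) fun θ => by simp [Complex.norm_exp_ofReal_mul_I]
  have hre : Continuous fun θ : ℝ => (g (Complex.exp (θ * Complex.I))).re :=
    Complex.continuous_re.comp hc
  have h1 : (Real.circleAverage g 0 1).re =
      (2 * Real.pi)⁻¹ * ∫ θ in 0..2 * Real.pi, (g (Complex.exp (θ * Complex.I))).re := by
    rw [Real.circleAverage_def, Complex.smul_re, smul_eq_mul]
    congr 1
    simp only [circleMap, zero_add, Complex.ofReal_one, one_mul]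
    exact (Complex.reCLM.intervalIntegral_comp_comm (hc.intervalIntegrable _ _)).symm
  have h2 : ∫ θ in Real.pi..2 * Real.pi, (g (Complex.exp (θ * Complex.I))).re =
      ∫ θ in 0..Real.pi, (g (Complex.exp (((2 * Real.pi - θ : ℝ) : ℂ) * Complex.I))).re := by
    rw [intervalIntegral.integral_comp_sub_left
      (fun θ : ℝ => (g (Complex.exp (θ * Complex.I))).re)]
    congr 1 <;> ring
  have h3 : ∫ θ in Set.Ioo 0 Real.pi,
      (g (Complex.exp (((2 * Real.pi - θ : ℝ) : ℂ) * Complex.I))).re =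
      ∫ θ in Set.Ioo 0 Real.pi, (g (Complex.exp (θ * Complex.I))).re := by
    refine setIntegral_congr_fun measurableSet_Ioo fun θ hθ => ?_
    have : Complex.exp (((2 * Real.pi - θ : ℝ) : ℂ) * Complex.I) =
        starRingEnd ℂ (Complex.exp (θ * Complex.I)) := by
      rw [← Complex.exp_conj, map_mul, Complex.conj_ofReal, Complex.conj_I]
      push_cast
      rw [sub_mul, Complex.exp_sub, Complex.exp_two_pi_mul_I, mul_neg, Complex.exp_neg, one_div]
    simp only [this]
    rw [hconj θ hθ, Complex.conj_re]
  rw [h1, ← intervalIntegral.integral_add_adjacent_intervals (b := Real.pi)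
    (hre.intervalIntegrable _ _) (hre.intervalIntegrable _ _), h2,
    intervalIntegral.integral_of_le Real.pi_pos.le, intervalIntegral.integral_of_le Real.pi_pos.le,
    integral_Ioc_eq_integral_Ioo, integral_Ioc_eq_integral_Ioo, h3, ← two_mul, ← mul_assoc]
  congr 1
  have := Real.pi_pos
  field_simp

theorem aeval_conj_complex (p : ℝ[X]) (z : ℂ) :
    aeval (starRingEnd ℂ z) p = starRingEnd ℂ (aeval z p) :=
  aeval_algHom_apply Complex.conjAe.toAlgHom z p

theorem xOf_exp (a b θ : ℝ) :
    xOf a b (Complex.exp (θ * Complex.I)) = ((2 * a * Real.cos θ + b : ℝ) : ℂ) := by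
  rw [xOf, one_div, ← Complex.exp_neg, ← neg_mul]
  push_cast
  rw [Complex.cos]
  ring

theorem two_mul_sin_mul_bsDensity {a : ℝ} (ha : 0 < a) (f : ℝ[X]) (θ : ℝ) :
    2 * a * Real.sin θ * bsDensity a f θ =
      2 / Real.pi * (Real.sin θ ^ 2 / ‖aeval (Complex.exp (θ * Complex.I)) f‖ ^ 2) := by
  rw [bsDensity, ← div_div, ← div_div]
  field_simp

theorem exp_sub_one_div (θ : ℝ) : Complex.exp (θ * Complex.I) -
    1 / Complex.exp (θ * Complex.I) = 2 * Real.sin θ * Complex.I := by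
  rw [one_div, ← Complex.exp_neg, ← neg_mul, Complex.ofReal_sin, Complex.sin]
  linear_combination (-(Complex.exp (-θ * Complex.I) - Complex.exp (θ * Complex.I))) * Complex.I_sq

/-- In the variable θ the density with its Jacobian is |g|²/(2π), where g extends (z² - 1)/f
continuously. So possible zeros of f at ±1 cause no singularity. -/
theorem HasJostZeros.integrable_bsContinuousPart {f : ℝ[X]} (hf : HasJostZeros f) {a : ℝ}
    (ha : 0 < a) (b : ℝ) {u : ℝ → ℝ} (hu : Continuous u) :
    Integrable u (bsContinuousPart a b f) := by
  rw [(bsContinuousPart_integral ha b f u).1]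
  obtain ⟨g, hg, hgf, -⟩ := hf.exists_circleAverage_eq 1
  have hc : Continuous fun θ : ℝ => g (Complex.exp (θ * Complex.I)) :=
    hg.comp_continuous (by fun_prop) fun θ => by simp [Complex.norm_exp_ofReal_mul_I]
  have hc2 : Continuous fun θ : ℝ => (2 * Real.pi)⁻¹ * ‖g (Complex.exp (θ * Complex.I))‖ ^ 2 *
      u (2 * a * Real.cos θ + b) :=
    (continuous_const.mul (hc.norm.pow 2)).mul (hu.comp (by fun_prop))
  refine ((hc2.integrableOn_Icc (a := 0) (b := Real.pi)).mono_set Set.Ioo_subset_Icc_self).congr_fun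
    (fun θ hθ => ?_) measurableSet_Ioo
  have hne := hf.aeval_exp_ne_zero hθ
  simp only
  rw [two_mul_sin_mul_bsDensity ha]
  congr 1
  set z := Complex.exp (θ * Complex.I) with hz
  have hz1 : ‖z‖ = 1 := Complex.norm_exp_ofReal_mul_I θ
  have hz0 : z ≠ 0 := Complex.exp_ne_zero _
  have h1 := hgf z (by simpa using hz1)
  have h2 : z ^ 2 - 1 = z * (2 * Real.sin θ * Complex.I) := by
    rw [← exp_sub_one_div θ, ← hz]
    field_simp
  have h3 : 2 * |Real.sin θ| = ‖g z‖ * ‖aeval z f‖ := by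
    have := congrArg norm h1
    rw [h2] at this
    rw [norm_mul, norm_mul, norm_mul, norm_mul, norm_mul, hz1, Complex.norm_real] at this
    simpa using this
  have hn : ‖aeval z f‖ ≠ 0 := norm_ne_zero_iff.2 hne
  have h4 : ‖g z‖ = 2 * |Real.sin θ| / ‖aeval z f‖ := by rw [h3]; field_simp
  rw [h4, div_pow, mul_pow, sq_abs]
  have := Real.pi_pos
  field_simp

/-- On the unit circle the identity for q says sin θ · q(x) = Im(z^(n+1) conj f(z)). One factor f
then cancels from |f|², and the integrand becomes -Re g/π with g = (z² - 1) z^n r(x) / f(z), whose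
average is a sum of residues. -/
theorem HasJostZeros.integral_bsContinuousPart {f : ℝ[X]} (hf : HasJostZeros f) {a : ℝ}
    (ha : 0 < a) (b : ℝ) {n : ℕ} {q r : ℝ[X]} (hr : r.natDegree ≤ n)
    (hq : ∀ z : ℂ, z ≠ 0 → (z - 1 / z) * aeval (xOf a b z) q =
      z ^ (n + 1) * aeval (1 / z) f - (1 / z) ^ (n + 1) * aeval z f) :
    ∫ x, q.eval x * r.eval x ∂(bsContinuousPart a b f) = r.coeff n * a ^ n / f.eval 0 -
      ∑ w ∈ diskZeros f, (w ^ 2 - 1) * (joukowskyLift a b n r).eval w /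
        (w * (derivative f).eval w) := by
  obtain ⟨g, hg, hgf, hav⟩ := hf.exists_circleAverage_eq (joukowskyLift a b n r)
  have hconj : ∀ θ ∈ Set.Ioo 0 Real.pi, g (starRingEnd ℂ (Complex.exp (θ * Complex.I))) =
      starRingEnd ℂ (g (Complex.exp (θ * Complex.I))) := by
    intro θ hθ
    have hne := hf.aeval_exp_ne_zero hθ
    set z := Complex.exp (θ * Complex.I) with hz
    have hz1 : ‖z‖ = 1 := Complex.norm_exp_ofReal_mul_I θ
    have h1 := congrArg (starRingEnd ℂ) (hgf z (by simpa using hz1))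
    have h2 := hgf (starRingEnd ℂ z) (by simpa using hz1)
    rw [aeval_conj_complex, aeval_conj_complex] at h2
    simp only [map_mul, map_sub, map_pow, map_one] at h1
    rw [h1] at h2
    exact (mul_right_cancel₀ (by simpa using hne) h2).symm
  have hre := circleAverage_re_eq hg hconj
  rw [hav, Complex.ofReal_re, eval_zero_joukowskyLift] at hre
  rw [(bsContinuousPart_integral ha b f _).2]
  have hint : ∫ θ in Set.Ioo 0 Real.pi, 2 * a * Real.sin θ * bsDensity a f θ *
      (q.eval (2 * a * Real.cos θ + b) * r.eval (2 * a * Real.cos θ + b)) =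
      ∫ θ in Set.Ioo 0 Real.pi, -Real.pi⁻¹ * (g (Complex.exp (θ * Complex.I))).re := by
    refine setIntegral_congr_fun measurableSet_Ioo fun θ hθ => ?_
    have hne := hf.aeval_exp_ne_zero hθ
    have hx := xOf_exp a b θ
    rw [two_mul_sin_mul_bsDensity ha]
    have hs := exp_sub_one_div θ
    set z := Complex.exp (θ * Complex.I) with hz
    have hz1 : ‖z‖ = 1 := Complex.norm_exp_ofReal_mul_I θ
    have hz0 : z ≠ 0 := Complex.exp_ne_zero _
    have h1 := hgf z (by simpa using hz1)
    rw [aeval_joukowskyLift a b hr hz0, hx, aeval_ofReal_complex] at h1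
    have h2 := hq z hz0
    rw [hs, hx, aeval_ofReal_complex] at h2
    have hinv : 1 / z = starRingEnd ℂ z := by
      rw [one_div, Complex.inv_def, Complex.normSq_eq_norm_sq, hz1]
      simp
    rw [hinv, aeval_conj_complex] at h2
    set F := aeval z f with hF
    set Q := q.eval (2 * a * Real.cos θ + b)
    set T := r.eval (2 * a * Real.cos θ + b)
    set s := Real.sin θ
    have h3 : z ^ 2 - 1 = z * (2 * s * Complex.I) := by
      rw [← hs]
      field_simp
    set y := z ^ (n + 1) * starRingEnd ℂ F with hy
    have hyc : starRingEnd ℂ z ^ (n + 1) * F = starRingEnd ℂ y := by simp [hy]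
    have h4 : s * Q = y.im := by
      rw [hyc, Complex.sub_conj] at h2
      have h5 := congrArg Complex.im h2
      simp at h5
      linarith
    have h6 : g z = 2 * s * T * Complex.I * y / (‖F‖ ^ 2 : ℝ) := by
      have hn : ((‖F‖ ^ 2 : ℝ) : ℂ) ≠ 0 := by
        exact_mod_cast pow_ne_zero 2 (norm_ne_zero_iff.2 hne)
      rw [eq_div_iff hn, Complex.ofReal_pow, ← Complex.mul_conj', ← mul_assoc, ← h1, h3, hy]
      ring
    have h7 : (g z).re = -(2 * s * T * y.im / ‖F‖ ^ 2) := by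
      rw [h6, Complex.div_ofReal_re]
      have : (2 * s * T * Complex.I * y : ℂ) = ((2 * s * T : ℝ) : ℂ) * (Complex.I * y) := by
        push_cast; ring
      rw [this, Complex.re_ofReal_mul, Complex.I_mul_re]
      ring
    rw [h7, ← h4]
    ring
  rw [hint, integral_const_mul, neg_mul, ← hre]
  ring

/-! ### Integration against the Bernstein–Szegő measure -/

theorem integrable_bsPointMasses (a b : ℝ) (f : ℝ[X]) {u : ℝ → ℝ} :
    Integrable u (bsPointMasses a b f) := by
  rw [bsPointMasses, integrable_finsetSum_measure]
  exact fun _ _ => (integrable_dirac (by simp)).smul_measure (by simp)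

theorem HasJostZeros.integrable_bs {f : ℝ[X]} (hf : HasJostZeros f) {a : ℝ} (ha : 0 < a) (b : ℝ)
    {u : ℝ → ℝ} (hu : Continuous u) :
    Integrable u (bsContinuousPart a b f + bsPointMasses a b f) :=
  (hf.integrable_bsContinuousPart ha b hu).add_measure (integrable_bsPointMasses a b f)

/-- The polynomials generated by `f` are orthogonal with respect to the Bernstein–Szegő measure. -/
theorem HasJostZeros.integral_bs {f : ℝ[X]} (hf : HasJostZeros f) {a : ℝ} (ha : 0 < a) (b : ℝ)
    (hpos : ∀ z ∈ diskZeros f, 0 < canonicalMass a b f z) {n : ℕ} {q r : ℝ[X]}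
    (hr : r.natDegree ≤ n)
    (hq : ∀ z : ℂ, z ≠ 0 → (z - 1 / z) * aeval (xOf a b z) q =
      z ^ (n + 1) * aeval (1 / z) f - (1 / z) ^ (n + 1) * aeval z f) :
    ∫ x, q.eval x * r.eval x ∂(bsContinuousPart a b f + bsPointMasses a b f) =
      r.coeff n * a ^ n / f.eval 0 := by
  rw [integral_add_measure (hf.integrable_bsContinuousPart ha b (by fun_prop))
    (integrable_bsPointMasses a b f), hf.integral_bsContinuousPart ha b hr hq, bsPointMasses,
    integral_finsetSum_measure
      (fun _ _ => (integrable_dirac enorm_lt_top).smul_measure (by simp)), sub_add, sub_eq_self,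
    ← Finset.sum_sub_distrib]
  refine Finset.sum_eq_zero fun w hw => ?_
  rw [integral_smul_measure, integral_dirac, ENNReal.toReal_ofReal (hpos w hw).le, smul_eq_mul]
  obtain ⟨hw0, hw1⟩ := (mem_diskZeros hf.eval_zero_pos.ne').1 hw
  have hne := ne_zero_of_eval_eq_zero hf.eval_zero_pos.ne' hw0
  have hnec : (w : ℂ) ≠ 0 := by exact_mod_cast hne
  rw [canonicalMass_eq ha b f hne hw1 hw0]
  -- At a zero w the term with f(w) disappears, so q is proportional to f(1/w). This cancels the
  -- f(1/w) in the canonical mass, leaving precisely the residue at w.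
  have hq' : (w - 1 / w) * q.eval (a * (w + 1 / w) + b) = w ^ (n + 1) * f.eval (1 / w) := by
    have h1 := hq w hnec
    have h2 : (1 / w : ℂ) = ((1 / w : ℝ) : ℂ) := by push_cast; rfl
    rw [xOf_ofReal, h2] at h1
    simp only [aeval_ofReal_complex, hw0] at h1
    have h3 : ((w - 1 / w) * q.eval (a * (w + 1 / w) + b) : ℝ) = w ^ (n + 1) * f.eval (1 / w) -
      (1 / w) ^ (n + 1) * 0 := by exact_mod_cast h1
    rw [h3]
    ring
  have hr' : (joukowskyLift a b n r).eval w = w ^ n * r.eval (a * (w + 1 / w) + b) := by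
    have h1 := aeval_joukowskyLift a b hr hnec
    rw [xOf_ofReal] at h1
    simp only [aeval_ofReal_complex] at h1
    exact_mod_cast h1
  have hd : (derivative f).eval w ≠ 0 := by
    intro h
    refine hf.simple_of_zero w (by simpa using hw1.le) ?_ ?_ <;> rw [aeval_ofReal_complex]
    · rw [hw0]; simp
    · rw [h]; simp
  have hfi : f.eval (1 / w) ≠ 0 := by
    intro h
    have hw1' : w ≠ 1 := by rintro rfl; simp at hw1
    have hwm : w ≠ -1 := by rintro rfl; simp at hw1
    refine hf.no_common_zero w hnec (by exact_mod_cast hw1') (by exact_mod_cast hwm) ?_ ?_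
    · rw [aeval_ofReal_complex, hw0]; simp
    · rw [show (1 / w : ℂ) = ((1 / w : ℝ) : ℂ) by push_cast; rfl, aeval_ofReal_complex, h]; simp
  rw [hr', sub_eq_zero]
  have e : (w - 1 / w) * (1 - 1 / w ^ 2) / ((derivative f).eval w * f.eval (1 / w)) *
      (q.eval (a * (w + 1 / w) + b) * r.eval (a * (w + 1 / w) + b)) =
      (1 - 1 / w ^ 2) / ((derivative f).eval w * f.eval (1 / w)) *
      ((w - 1 / w) * q.eval (a * (w + 1 / w) + b)) * r.eval (a * (w + 1 / w) + b) := by ring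
  rw [e, hq']
  generalize r.eval (a * (w + 1 / w) + b) = t
  generalize f.eval (1 / w) = v at *
  field_simp
  ring

theorem exists_bs_compl_Icc_eq_zero {f : ℝ[X]} (a b : ℝ) :
    ∃ M : ℝ, (bsContinuousPart a b f + bsPointMasses a b f) (Set.Icc (-M) M)ᶜ = 0 := by
  set M := |b - 2 * a| + |b + 2 * a| + ∑ z ∈ diskZeros f, |a * (z + 1 / z) + b|
  have hS : 0 ≤ ∑ z ∈ diskZeros f, |a * (z + 1 / z) + b| := Finset.sum_nonneg fun _ _ => abs_nonneg _
  refine ⟨M, ?_⟩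
  rw [Measure.add_apply, add_eq_zero]
  constructor
  · refine withDensity_absolutelyContinuous _ _ ?_
    rw [Measure.restrict_apply measurableSet_Icc.compl, Set.inter_comm,
      ← Set.sdiff_eq, Set.sdiff_eq_empty.2, measure_empty]
    rintro x ⟨h1, h2⟩
    have h3 := neg_abs_le (b - 2 * a)
    have h4 := le_abs_self (b + 2 * a)
    have h5 := abs_nonneg (b - 2 * a)
    have h6 := abs_nonneg (b + 2 * a)
    constructor <;> linarith
  · rw [bsPointMasses, Measure.finsetSum_apply]
    refine Finset.sum_eq_zero fun z hz => ?_
    have h1 := Finset.single_le_sum (f := fun z => |a * (z + 1 / z) + b|)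
      (fun _ _ => abs_nonneg _) hz
    have h5 := abs_nonneg (b - 2 * a)
    have h6 := abs_nonneg (b + 2 * a)
    have h7 : |a * (z + 1 / z) + b| ≤ M := by linarith
    rw [Measure.smul_apply, Measure.dirac_apply' _ measurableSet_Icc.compl,
      Set.indicator_of_notMem (Set.notMem_compl_iff.2 (Set.mem_Icc.2 (abs_le.1 h7))), smul_zero]

/-! ### Determinacy of the moment problem for compactly supported measures -/

/-- Markov's inequality for x^(2k) bounds ρ(|x| > R) by μ(ℝ) (M/R)^(2k), which tends to 0. Thus
equality of moments transfers the bounded support to ρ. -/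
theorem measure_compl_Icc_eq_zero_of_moments {ρ μ : Measure ℝ} [IsFiniteMeasure ρ]
    [IsFiniteMeasure μ] (hρ : ∀ p : ℝ[X], Integrable (fun x => p.eval x) ρ)
    (heq : ∀ p : ℝ[X], ∫ x, p.eval x ∂ρ = ∫ x, p.eval x ∂μ) {M R : ℝ} (hM : 0 ≤ M) (hMR : M < R)
    (hμ : μ (Set.Icc (-M) M)ᶜ = 0) : ρ (Set.Icc (-R) R)ᶜ = 0 := by
  have hR : 0 < R := hM.trans_lt hMR
  have hae : ∀ᵐ x ∂μ, |x| ≤ M := by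
    rw [ae_iff]
    convert hμ using 2
    ext x
    simp [abs_le]
  have hk (k : ℕ) : ρ.real (Set.Icc (-R) R)ᶜ ≤ μ.real Set.univ * ((M / R) ^ 2) ^ k := by
    have h1 := mul_meas_ge_le_integral_of_nonneg (μ := ρ) (f := fun x => x ^ (2 * k))
      (Filter.Eventually.of_forall fun x => (even_two_mul k).pow_nonneg x)
      (by simpa using hρ (X ^ (2 * k))) (R ^ (2 * k))
    have h2 : ∫ x, x ^ (2 * k) ∂ρ = ∫ x, x ^ (2 * k) ∂μ := by simpa using heq (X ^ (2 * k))
    have h3 : ‖∫ x, x ^ (2 * k) ∂μ‖ ≤ M ^ (2 * k) * μ.real Set.univ := by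
      refine norm_integral_le_of_norm_le_const ?_
      filter_upwards [hae] with x hx
      rw [norm_pow, Real.norm_eq_abs]
      gcongr
    have h4 : ρ.real (Set.Icc (-R) R)ᶜ ≤ ρ.real {x | R ^ (2 * k) ≤ x ^ (2 * k)} := by
      refine measureReal_mono fun x hx => ?_
      have hx' : R < |x| := by
        by_contra h
        exact hx (Set.mem_Icc.2 (abs_le.1 (not_lt.1 h)))
      change R ^ (2 * k) ≤ x ^ (2 * k)
      rw [← Even.pow_abs (even_two_mul k) x]
      gcongr
    have h5 : R ^ (2 * k) * ρ.real (Set.Icc (-R) R)ᶜ ≤ M ^ (2 * k) * μ.real Set.univ := by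
      refine (mul_le_mul_of_nonneg_left h4 (by positivity)).trans (h1.trans ?_)
      rw [h2]
      exact (le_abs_self _).trans h3
    rw [← pow_mul, div_pow, mul_div_assoc', le_div_iff₀ (by positivity)]
    linarith
  have hlim : Filter.Tendsto (fun k : ℕ => μ.real Set.univ * ((M / R) ^ 2) ^ k) Filter.atTop
      (nhds (μ.real Set.univ * 0)) := by
    refine (tendsto_pow_atTop_nhds_zero_of_lt_one (by positivity) ?_).const_mul _
    refine pow_lt_one₀ (by positivity) ?_ two_ne_zero
    rwa [div_lt_one hR]
  rw [mul_zero] at hlim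
  have h0 : ρ.real (Set.Icc (-R) R)ᶜ ≤ 0 := ge_of_tendsto' hlim hk
  exact (measureReal_eq_zero_iff).1 (le_antisymm h0 measureReal_nonneg)

/-- Both measures live on one compact interval, where Weierstrass approximation extends equality of
integrals from polynomials to bounded continuous functions. -/
theorem eq_of_moments_of_compactSupport {ρ μ : Measure ℝ} [IsFiniteMeasure ρ]
    [IsFiniteMeasure μ] (hρ : ∀ p : ℝ[X], Integrable (fun x => p.eval x) ρ)
    (hμ : ∀ p : ℝ[X], Integrable (fun x => p.eval x) μ)
    (heq : ∀ p : ℝ[X], ∫ x, p.eval x ∂ρ = ∫ x, p.eval x ∂μ) {M : ℝ}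
    (hM : μ (Set.Icc (-M) M)ᶜ = 0) : ρ = μ := by
  set R := |M| + 1
  have hM' : μ (Set.Icc (-|M|) |M|)ᶜ = 0 := measure_mono_null (Set.compl_subset_compl.2
    (Set.Icc_subset_Icc (neg_le_neg (le_abs_self M)) (le_abs_self M))) hM
  have hρR : ρ (Set.Icc (-R) R)ᶜ = 0 :=
    measure_compl_Icc_eq_zero_of_moments hρ heq (abs_nonneg M) (lt_add_one _) hM'
  have hμR : μ (Set.Icc (-R) R)ᶜ = 0 :=
    measure_compl_Icc_eq_zero_of_moments hμ (fun _ => rfl) (abs_nonneg M) (lt_add_one _) hM'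
  refine ext_of_forall_integral_eq_of_IsFiniteMeasure fun φ => ?_
  set T := ρ.real Set.univ + μ.real Set.univ with hT
  have hT0 : 0 ≤ T := by positivity
  have key : ∀ ε > 0, |∫ x, φ x ∂ρ - ∫ x, φ x ∂μ| ≤ ε * T := by
    intro ε hε
    obtain ⟨p, hp⟩ := exists_polynomial_near_of_continuousOn (-R) R φ φ.continuous.continuousOn ε hε
    have hsub {ν : Measure ℝ} [IsFiniteMeasure ν] (hν : Integrable (fun x => p.eval x) ν)
        (hνR : ν (Set.Icc (-R) R)ᶜ = 0) :
        |∫ x, φ x ∂ν - ∫ x, p.eval x ∂ν| ≤ ε * ν.real Set.univ := by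
      rw [← integral_sub (φ.integrable ν) hν, ← Real.norm_eq_abs]
      refine norm_integral_le_of_norm_le_const ?_
      have : ∀ᵐ x ∂ν, x ∈ Set.Icc (-R) R := by rw [ae_iff]; exact hνR
      filter_upwards [this] with x hx
      rw [Real.norm_eq_abs, abs_sub_comm]
      exact (hp x hx).le
    have h1 := hsub (hρ p) hρR
    have h2 := hsub (hμ p) hμR
    rw [heq p] at h1
    rw [abs_le] at *
    constructor <;> linarith
  have hle : |∫ x, φ x ∂ρ - ∫ x, φ x ∂μ| ≤ 0 := by
    refine le_of_forall_pos_le_add fun δ hδ => ?_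
    refine (key (δ / (T + 1)) (by positivity)).trans ?_
    rw [zero_add, div_mul_eq_mul_div, div_le_iff₀ (by positivity)]
    nlinarith
  exact sub_eq_zero.1 (abs_nonpos_iff.1 hle)

/-! ### Integration of polynomials as a linear functional -/

/-- Integration of polynomials against a measure with finite moments. -/
def polyIntegral (μ : Measure ℝ) (h : ∀ p : ℝ[X], Integrable (fun x => p.eval x) μ) :
    ℝ[X] →ₗ[ℝ] ℝ where
  toFun p := ∫ x, p.eval x ∂μ
  map_add' p q := by
    simp only [eval_add]
    exact integral_add (h p) (h q)
  map_smul' c p := by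
    simp only [eval_smul, smul_eq_mul, RingHom.id_apply]
    exact integral_const_mul c _

theorem map_C_mul (L : ℝ[X] →ₗ[ℝ] ℝ) (c : ℝ) (p : ℝ[X]) : L (C c * p) = c * L p := by
  rw [← smul_eq_C_mul, map_smul, smul_eq_mul]

theorem integrable_polynomial_eval {μ : Measure ℝ}
    (h : ∀ n : ℕ, Integrable (fun x : ℝ => x ^ n) μ) (p : ℝ[X]) :
    Integrable (fun x => p.eval x) μ := by
  simp only [eval_eq_sum_range]
  exact integrable_finsetSum _ fun k _ => (h k).const_mul _

/-- Orthonormality of the `p_n` for large `n` propagates downwards along the recurrence. -/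
theorem apply_recPoly_mul_of_eventually {A : ℕ → ℝ} {B : ℕ → ℝ} (hA : ∀ n, 1 ≤ n → 0 < A n)
    (L : ℝ[X] →ₗ[ℝ] ℝ) {n₀ : ℕ}
    (h : ∀ n, n₀ ≤ n → ∀ r : ℝ[X], r.natDegree ≤ n →
      L (recPoly A B n * r) = r.coeff n / (recPoly A B n).coeff n) (n : ℕ) (r : ℝ[X])
    (hr : r.natDegree ≤ n) : L (recPoly A B n * r) = r.coeff n / (recPoly A B n).coeff n := by
  suffices H : ∀ d n, n₀ ≤ n + d → ∀ r : ℝ[X], r.natDegree ≤ n →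
      L (recPoly A B n * r) = r.coeff n / (recPoly A B n).coeff n from
    H n₀ n (Nat.le_add_left _ _) r hr
  intro d
  induction d with
  | zero => exact h
  | succ d ih =>
    intro n hn r hr
    have h1 := ih (n + 1) (by lia) ((X - C (B (n + 1))) * r) (by
      refine natDegree_mul_le.trans ?_
      have := natDegree_X_sub_C_le (B (n + 1))
      lia)
    have h2 := ih (n + 2) (by lia) r (by lia)
    have hrec := C_mul_recPoly_succ B hA (n + 1)
    rw [prevTerm] at hrec
    have h3 : r.coeff (n + 1) = 0 := coeff_eq_zero_of_natDegree_lt (by lia)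
    have h4 : r.coeff (n + 2) = 0 := coeff_eq_zero_of_natDegree_lt (by lia)
    rw [sub_mul, coeff_sub, coeff_X_mul, coeff_C_mul, h3, mul_zero, sub_zero] at h1
    rw [h4, zero_div] at h2
    have hpos := hA (n + 1) (by lia)
    have hc := coeff_recPoly_pos B hA (n + 1)
    rw [← coeff_recPoly_succ B hA n]
    -- The recurrence is solved for a_{n+1} p_n. The term with p_{n+2} pairs to 0 with r because deg
    -- r ≤ n, and the term with p_{n+1} sees the leading coefficient of (x - b_{n+1}) r.
    have h5 : A (n + 1) * L (recPoly A B n * r) =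
        r.coeff n / (recPoly A B (n + 1)).coeff (n + 1) := by
      rw [← map_C_mul, ← h1]
      have : C (A (n + 1)) * (recPoly A B n * r) =
          recPoly A B (n + 1) * (X * r - C (B (n + 1)) * r) -
            C (A (n + 2)) * (recPoly A B (n + 2) * r) := by
        linear_combination r * hrec
      rw [this, map_sub, map_C_mul, h2, mul_zero, sub_zero]
    rw [eq_div_iff (by positivity)]
    rw [eq_div_iff hc.ne'] at h5
    linarith

theorem isFiniteMeasure_of_integrable_polynomial {μ : Measure ℝ}
    (h : ∀ p : ℝ[X], Integrable (fun x => p.eval x) μ) : IsFiniteMeasure μ := by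
  have h1 := h 1
  simp only [eval_one] at h1
  exact (integrable_const_iff_isFiniteMeasure one_ne_zero).1 h1

theorem HasRecurrenceCoefficients.integral_recPoly {ρ : Measure ℝ} {A B : ℕ → ℝ}
    (hρ : HasRecurrenceCoefficients ρ A B) (n : ℕ) :
    ∫ x, (recPoly A B n).eval x ∂ρ = if n = 0 then 1 else 0 := by
  have := hρ.orthonormal n 0
  simpa [recPoly] using this

/-- If the coefficients are constant from `n₀` on, the measure is of Bernstein–Szegő type. -/
theorem isBernsteinSzego_jostPoly {ρ : Measure ℝ} {A B : ℕ → ℝ}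
    (hρ : HasRecurrenceCoefficients ρ A B) {a b : ℝ} (ha : 0 < a) {n₀ : ℕ}
    (h : ∀ n, n₀ ≤ n → A (n + 1) = a ∧ B n = b) :
    IsBernsteinSzego ρ a b (jostPoly A B a b n₀) := by
  have hA := hρ.pos
  have hf := hasJostZeros_jostPoly B hA ha b n₀
  have hpos := canonicalMass_jostPoly_pos B hA ha b n₀
  refine ⟨hpos, ?_⟩
  change ρ = bsContinuousPart a b (jostPoly A B a b n₀) + bsPointMasses a b (jostPoly A B a b n₀)
  set μ := bsContinuousPart a b (jostPoly A B a b n₀) + bsPointMasses a b (jostPoly A B a b n₀)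
  have hiρ := integrable_polynomial_eval hρ.integrable_pow
  have hiμ (p : ℝ[X]) : Integrable (fun x => p.eval x) μ := hf.integrable_bs ha b (by fun_prop)
  have := isFiniteMeasure_of_integrable_polynomial hiρ
  have := isFiniteMeasure_of_integrable_polynomial hiμ
  obtain ⟨M, hM⟩ := exists_bs_compl_Icc_eq_zero (f := jostPoly A B a b n₀) a b
  refine eq_of_moments_of_compactSupport hiρ hiμ ?_ hM
  -- For n ≥ n₀ the generating polynomial is also ψ̂_n, whose value at 0 is κ_n a^n with κ_n the
  -- leading coefficient of p_n. The residue formula therefore becomes orthonormality.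
  have hμ := apply_recPoly_mul_of_eventually (B := B) hA (polyIntegral μ hiμ) (n₀ := n₀)
    (fun n hn r hr => by
      have h1 := hf.integral_bs ha b hpos (q := recPoly A B n) hr (fun z hz => by
        rw [sub_mul_aeval_recPoly B hA ha b n hz, jostPoly_eq_of_le ha h hn])
      have h0 : (jostPoly A B a b n₀).eval 0 = (recPoly A B n).coeff n * a ^ n := by
        rw [← jostPoly_eq_of_le ha h hn, eval_zero_jostPoly B hA]
      rw [h0] at h1
      have h2 : polyIntegral μ hiμ (recPoly A B n * r) =
          ∫ x, (recPoly A B n).eval x * r.eval x ∂μ := by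
        simp [polyIntegral]
      rw [h2]
      refine h1.trans ?_
      have := coeff_recPoly_pos B hA n
      field_simp)
  intro p
  change polyIntegral ρ hiρ p = polyIntegral μ hiμ p
  -- After expansion in the p_k it suffices to compare the integrals of p_k itself, which are 1 for
  -- k = 0 and 0 otherwise under both measures.
  obtain ⟨c, hc⟩ := exists_eq_sum_recPoly B hA (p.natDegree + 1) p (Nat.lt_succ_self _)
  rw [hc, map_sum, map_sum]
  refine Finset.sum_congr rfl fun k _ => ?_
  rw [map_C_mul, map_C_mul]
  congr 1
  refine (hρ.integral_recPoly k).trans ?_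
  have h1 := hμ k 1 (by simp)
  rw [mul_one] at h1
  rw [h1, coeff_one]
  by_cases hk : k = 0
  · subst hk
    simp [recPoly]
  · rw [if_neg hk, zero_div]

/-! ### The orthogonal polynomials generated by a polynomial `f` -/

/-- This is sin θ · U_m(cos θ) = sin((m + 1)θ) with z for e^{iθ}. Integer indices are needed because
`genPoly` uses U_{m-k} with m - k possibly negative; two consecutive indices are carried through the
induction. -/
theorem sub_inv_mul_aeval_U {z : ℂ} (hz : z ≠ 0) (m : ℤ) :
    (z - z⁻¹) * aeval ((z + z⁻¹) / 2) (Chebyshev.U ℝ m) = z ^ (m + 1) - (z⁻¹) ^ (m + 1) := by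
  suffices H : ∀ m : ℤ, (z - z⁻¹) * aeval ((z + z⁻¹) / 2) (Chebyshev.U ℝ m) =
      z ^ (m + 1) - (z⁻¹) ^ (m + 1) ∧
      (z - z⁻¹) * aeval ((z + z⁻¹) / 2) (Chebyshev.U ℝ (m + 1)) =
      z ^ (m + 1 + 1) - (z⁻¹) ^ (m + 1 + 1) from (H m).1
  have hz' : z⁻¹ ≠ 0 := inv_ne_zero hz
  intro m
  induction m using Int.induction_on with
  | zero =>
    simp only [zero_add, Chebyshev.U_zero, Chebyshev.U_one, map_one, map_mul, map_ofNat, aeval_X,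
      zpow_add₀ hz, zpow_add₀ hz', zpow_one]
    constructor <;> ring
  | succ m ih =>
    refine ⟨ih.2, ?_⟩
    rw [show (m : ℤ) + 1 + 1 = m + 2 by ring, Chebyshev.U_add_two]
    obtain ⟨h1, h2⟩ := ih
    simp only [zpow_add₀ hz, zpow_add₀ hz', zpow_one] at h1 h2
    rw [show (m : ℤ) + 2 + 1 = m + 1 + 1 + 1 by ring]
    simp only [zpow_add₀ hz, zpow_add₀ hz', zpow_one, map_sub, map_mul, aeval_X, map_ofNat]
    have e : z * z⁻¹ = 1 := mul_inv_cancel₀ hz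
    linear_combination (z + z⁻¹) * h2 - h1 + (z ^ (m : ℤ) * z - z⁻¹ ^ (m : ℤ) * z⁻¹) * e
  | pred m ih =>
    obtain ⟨h1, h2⟩ := ih
    rw [sub_add_cancel]
    refine ⟨?_, h1⟩
    rw [Chebyshev.U_sub_one]
    have h3 : z ^ (-(m : ℤ)) = z ^ (-(m : ℤ) + 1) * z⁻¹ := by
      rw [zpow_add₀ hz, zpow_one, mul_assoc, mul_inv_cancel₀ hz, mul_one]
    have h4 : z⁻¹ ^ (-(m : ℤ)) = z⁻¹ ^ (-(m : ℤ) + 1) * z := by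
      rw [zpow_add₀ hz', zpow_one, mul_assoc, inv_mul_cancel₀ hz, mul_one]
    rw [h3, h4]
    simp only [zpow_add₀ hz (-(m : ℤ) + 1), zpow_add₀ hz' (-(m : ℤ) + 1), zpow_one] at h2
    simp only [map_sub, map_mul, aeval_X, map_ofNat]
    linear_combination (z + z⁻¹) * h1 - h2

/-- The polynomial `q` with `(z - 1/z) q(x) = z ^ (m + 1) f(1/z) - z ^ (-(m + 1)) f(z)`. -/
def genPoly (a b : ℝ) (f : ℝ[X]) (m : ℤ) : ℝ[X] :=
  ∑ k ∈ Finset.range (f.natDegree + 1),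
    C (f.coeff k) * (Chebyshev.U ℝ (m - k)).comp (C (2 * a)⁻¹ * X - C (b / (2 * a)))

theorem sub_mul_aeval_genPoly {a : ℝ} (ha : 0 < a) (b : ℝ) (f : ℝ[X]) (m : ℤ) {z : ℂ}
    (hz : z ≠ 0) : (z - 1 / z) * aeval (xOf a b z) (genPoly a b f m) =
      z ^ (m + 1) * aeval (1 / z) f - (1 / z) ^ (m + 1) * aeval z f := by
  have ha' : (a : ℂ) ≠ 0 := by exact_mod_cast ha.ne'
  have hx : aeval (xOf a b z) (C (2 * a)⁻¹ * X - C (b / (2 * a)) : ℝ[X]) = (z + z⁻¹) / 2 := by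
    simp only [map_sub, map_mul, aeval_C, aeval_X, Complex.coe_algebraMap, xOf]
    push_cast
    field_simp
    ring
  have hz' : z⁻¹ ≠ 0 := inv_ne_zero hz
  rw [genPoly, map_sum, aeval_eq_sum_range, aeval_eq_sum_range, Finset.mul_sum, Finset.mul_sum,
    Finset.mul_sum, ← Finset.sum_sub_distrib]
  refine Finset.sum_congr rfl fun k _ => ?_
  rw [map_mul, aeval_comp, hx, aeval_C, Complex.coe_algebraMap, mul_left_comm, one_div,
    sub_inv_mul_aeval_U hz, Complex.real_smul, Complex.real_smul,
    show m - (k : ℤ) + 1 = (m + 1) + -(k : ℤ) by ring, zpow_add₀ hz, zpow_add₀ hz', zpow_neg,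
    zpow_neg, zpow_natCast, zpow_natCast, inv_pow, inv_inv]
  ring

/-- Each summand obeys the Chebyshev recurrence, in which twice the argument is (x - b)/a. -/
theorem C_mul_genPoly_add {a : ℝ} (ha : 0 < a) (b : ℝ) (f : ℝ[X]) (m : ℤ) :
    C a * (genPoly a b f (m + 1) + genPoly a b f (m - 1)) = (X - C b) * genPoly a b f m := by
  simp only [genPoly]
  rw [← Finset.sum_add_distrib, Finset.mul_sum, Finset.mul_sum]
  refine Finset.sum_congr rfl fun k _ => ?_
  rw [show m + 1 - (k : ℤ) = m - k + 1 by ring, Chebyshev.U_add_one,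
    show m - 1 - (k : ℤ) = m - k - 1 by ring]
  have h1 : C a * (2 * (C (2 * a)⁻¹ * X - C (b / (2 * a)))) = (X - C b : ℝ[X]) := by
    have e1 : C a * C 2 * C (2 * a)⁻¹ = (1 : ℝ[X]) := by
      rw [← C_mul, ← C_mul, ← C_1]
      congr 1
      field_simp
    have e2 : C a * C 2 * C (b / (2 * a)) = (C b : ℝ[X]) := by
      rw [← C_mul, ← C_mul]
      congr 1
      field_simp
    rw [C_ofNat] at e1 e2
    linear_combination X * e1 - e2
  simp only [sub_comp, mul_comp, X_comp, ofNat_comp]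
  linear_combination (C (f.coeff k) *
    (Chebyshev.U ℝ (m - k)).comp (C (2 * a)⁻¹ * X - C (b / (2 * a)))) * h1

theorem natDegree_linear_arg {a : ℝ} (ha : 0 < a) (b : ℝ) :
    (C (2 * a)⁻¹ * X - C (b / (2 * a)) : ℝ[X]).natDegree = 1 := by
  rw [sub_eq_add_neg, ← C_neg]
  exact natDegree_linear (by positivity)

/-- The reflection U_{-m-2} = -U_m makes the degree |m + 1| - 1, except that U_{-1} = 0; the two
hypotheses cover the two signs of m + 1. -/
theorem coeff_U_comp_eq_zero {a : ℝ} (ha : 0 < a) (b : ℝ) (m : ℤ) {j : ℕ} (h1 : m < j)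
    (h2 : -m < j + 2) :
    ((Chebyshev.U ℝ m).comp (C (2 * a)⁻¹ * X - C (b / (2 * a)))).coeff j = 0 := by
  by_cases hm : m = -1
  · rw [hm, Chebyshev.U_neg_one, zero_comp, coeff_zero]
  · apply coeff_eq_zero_of_natDegree_lt
    rw [natDegree_comp, natDegree_linear_arg ha b, mul_one, Chebyshev.natDegree_U]
    lia

/-- Here the bound 2n₀ enters: for k ≤ 2n₀ ≤ 2(m + 1) a reflected index k - m - 2 is at most m. The
case m = n₀ - 1 is included, as it is needed to recover b_{n₀} and f. -/
theorem coeff_genPoly_eq_zero {a : ℝ} (ha : 0 < a) (b : ℝ) {f : ℝ[X]} {n₀ : ℕ}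
    (hf : f.natDegree ≤ 2 * n₀) {m : ℤ} (hm : n₀ ≤ m + 1) {j : ℕ} (hj : m < j) :
    (genPoly a b f m).coeff j = 0 := by
  rw [genPoly, finsetSum_coeff]
  refine Finset.sum_eq_zero fun k hk => ?_
  have := Finset.mem_range.1 hk
  rw [coeff_C_mul, coeff_U_comp_eq_zero ha b _ (by lia) (by lia), mul_zero]

theorem coeff_genPoly {a : ℝ} (ha : 0 < a) (b : ℝ) {f : ℝ[X]} {n₀ : ℕ}
    (hf : f.natDegree ≤ 2 * n₀) {n : ℕ} (hn : n₀ ≤ n) :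
    (genPoly a b f n).coeff n = f.eval 0 / a ^ n := by
  rw [genPoly, finsetSum_coeff, Finset.sum_range_succ', Finset.sum_eq_zero, zero_add]
  · have h1 := coeff_comp_degree_mul_degree (p := Chebyshev.U ℝ (n : ℤ))
      (q := (C (2 * a)⁻¹ * X - C (b / (2 * a)) : ℝ[X])) (by rw [natDegree_linear_arg ha b]; simp)
    have h2 : (C (2 * a)⁻¹ * X - C (b / (2 * a)) : ℝ[X]).leadingCoeff = (2 * a)⁻¹ := by
      rw [sub_eq_add_neg, ← C_neg]
      exact leadingCoeff_linear (by positivity)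
    rw [natDegree_linear_arg ha b, mul_one, Chebyshev.natDegree_U_natCast,
      Chebyshev.leadingCoeff_U_natCast, h2] at h1
    rw [coeff_C_mul, Nat.cast_zero, sub_zero, h1, coeff_zero_eq_eval_zero, inv_pow, mul_pow]
    field_simp
  · intro k hk
    have := Finset.mem_range.1 hk
    rw [coeff_C_mul, coeff_U_comp_eq_zero ha b _ (by lia) (by lia), mul_zero]

/-- A measure of Bernstein–Szegő type generated by `f` has eventually constant coefficients, and
`f` is the polynomial `ψ̂_{n₀}`. -/
theorem eq_jostPoly_of_isBernsteinSzego {ρ : Measure ℝ} {A B : ℕ → ℝ}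
    (hρ : HasRecurrenceCoefficients ρ A B) {a b : ℝ} (ha : 0 < a) {n₀ : ℕ} {f : ℝ[X]}
    (hdeg : f.natDegree ≤ 2 * n₀) (hf : HasJostZeros f) (h : IsBernsteinSzego ρ a b f) :
    (∀ n, n₀ ≤ n → A (n + 1) = a ∧ B n = b) ∧ f = jostPoly A B a b n₀ := by
  have hA := hρ.pos
  have hiρ := integrable_polynomial_eval hρ.integrable_pow
  have hρeq : ρ = bsContinuousPart a b f + bsPointMasses a b f := h.eq
  have hf0 := hf.eval_zero_pos
  have hid (n : ℕ) (z : ℂ) (hz : z ≠ 0) :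
      (z - 1 / z) * aeval (xOf a b z) (genPoly a b f n) =
      z ^ (n + 1) * aeval (1 / z) f - (1 / z) ^ (n + 1) * aeval z f := by
    have := sub_mul_aeval_genPoly ha b f n hz
    exact_mod_cast this
  have hL (n : ℕ) (r : ℝ[X]) (hr : r.natDegree ≤ n) :
      polyIntegral ρ hiρ (genPoly a b f n * r) = r.coeff n * a ^ n / f.eval 0 := by
    rw [← hf.integral_bs ha b h.mass_pos hr (hid n), ← hρeq]
    simp [polyIntegral]
  have hkey : ∀ n, n₀ ≤ n → (recPoly A B n).coeff n * a ^ n = f.eval 0 ∧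
      genPoly a b f n = recPoly A B n := by
    intro n hn
    have hκ := coeff_recPoly_pos B hA n
    have hd : (genPoly a b f n).natDegree < n + 1 := by
      rw [Nat.lt_succ_iff, natDegree_le_iff_coeff_eq_zero]
      intro j hj
      exact coeff_genPoly_eq_zero ha b hdeg (by lia) (by exact_mod_cast hj)
    obtain ⟨c, hc⟩ := exists_eq_sum_recPoly B hA (n + 1) _ hd
    have hck : ∀ k ∈ Finset.range (n + 1),
        c k = (recPoly A B k).coeff n * a ^ n / f.eval 0 := by
      intro k hk
      have hkn := Finset.mem_range.1 hk
      have hdk := natDegree_recPoly_le (A := A) B k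
      rw [← hL n (recPoly A B k) (by lia), hc, Finset.sum_mul, map_sum,
        Finset.sum_eq_single_of_mem k hk]
      · rw [mul_assoc, map_C_mul]
        have : polyIntegral ρ hiρ (recPoly A B k * recPoly A B k) = 1 := by
          have := hρ.orthonormal k k
          simpa [polyIntegral] using this
        rw [this, mul_one]
      · intro j _ hj
        rw [mul_assoc, map_C_mul]
        have : polyIntegral ρ hiρ (recPoly A B j * recPoly A B k) = 0 := by
          have := hρ.orthonormal j k
          simpa [polyIntegral, hj] using this
        rw [this, mul_zero]
    have hq : genPoly a b f n = C ((recPoly A B n).coeff n * a ^ n / f.eval 0) *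
        recPoly A B n := by
      rw [hc, Finset.sum_range_succ, hck n (by simp), Finset.sum_eq_zero, zero_add]
      intro k hk
      have hkn := Finset.mem_range.1 hk
      have hdk := natDegree_recPoly_le (A := A) B k
      rw [hck k (Finset.mem_range.2 (by lia)),
        coeff_eq_zero_of_natDegree_lt (show (recPoly A B k).natDegree < n by lia)]
      simp
    have hcoef := coeff_genPoly ha b hdeg hn
    rw [hq, coeff_C_mul] at hcoef
    -- With κ_n the leading coefficient of p_n, orthogonality gives q_n = (κ_n a^n / f(0)) p_n,
    -- while q_n has leading coefficient f(0)/a^n. Only the square of κ_n a^n is determined so far;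
    -- f(0) > 0 fixes the sign.
    have hsq : ((recPoly A B n).coeff n * a ^ n) ^ 2 = (f.eval 0) ^ 2 := by
      field_simp at hcoef
      linear_combination hcoef
    have heq : (recPoly A B n).coeff n * a ^ n = f.eval 0 :=
      (pow_left_inj₀ (by positivity) hf0.le two_ne_zero).1 hsq
    refine ⟨heq, ?_⟩
    rw [hq, heq, div_self hf0.ne', C_1, one_mul]
  have hAa : ∀ n, n₀ ≤ n → A (n + 1) = a := by
    intro n hn
    have h1 := (hkey n hn).1
    have h2 := (hkey (n + 1) (by lia)).1
    have h3 := coeff_recPoly_succ B hA n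
    have h4 := coeff_recPoly_pos B hA (n + 1)
    rw [← h2, ← h3, pow_succ] at h1
    have h5 : (recPoly A B (n + 1)).coeff (n + 1) * a ^ n ≠ 0 := by positivity
    refine mul_right_cancel₀ h5 ?_
    linarith
  -- Subtracting the recurrences of q and p leaves q_{n-1}, which for n = n₀ is not yet known to be
  -- p_{n-1}. As its degree is below n, the coefficient of x^n yields b_n = b.
  have hrec : ∀ n, n₀ ≤ n → C a * genPoly a b f (n - 1) =
      C (B n - b) * recPoly A B n + prevTerm A B n := by
    intro n hn
    have h1 := C_mul_genPoly_add ha b f n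
    have h2 := C_mul_recPoly_succ B hA n
    have h3 := (hkey (n + 1) (by lia)).2
    push_cast at h3
    rw [h3, (hkey n hn).2] at h1
    rw [hAa n hn] at h2
    rw [C_sub]
    linear_combination h1 - h2
  have hBb : ∀ n, n₀ ≤ n → B n = b := by
    intro n hn
    have h1 := congrArg (fun p => p.coeff n) (hrec n hn)
    simp only [coeff_C_mul, coeff_add, coeff_prevTerm_eq_zero B n n le_rfl,
      coeff_genPoly_eq_zero ha b hdeg (m := (n : ℤ) - 1) (j := n) (by lia) (by lia)] at h1
    rw [mul_zero, add_zero, eq_comm, mul_eq_zero, sub_eq_zero] at h1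
    exact h1.resolve_right (coeff_recPoly_pos B hA n).ne'
  refine ⟨fun n hn => ⟨hAa n hn, hBb n hn⟩, ?_⟩
  -- Taking the identity for m = n₀ minus z times that for m = n₀ - 1 eliminates f(1/z) and gives
  -- f(z) = z^(n₀) (q_{n₀} - z q_{n₀-1}), the closed form of ψ̂_{n₀}. Points t > 1 avoid the zeros
  -- of z - 1/z.
  refine eq_of_infinite_eval_eq _ _ ((Set.Ioi_infinite (1 : ℝ)).mono fun t ht => ?_)
  have ht1 : (1 : ℝ) < t := ht
  have hz : (t : ℂ) ≠ 0 := by exact_mod_cast (by linarith : t ≠ 0)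
  suffices aeval (t : ℂ) f = aeval (t : ℂ) (jostPoly A B a b n₀) by
    rw [aeval_ofReal_complex, aeval_ofReal_complex] at this
    change f.eval t = (jostPoly A B a b n₀).eval t
    exact_mod_cast this
  have hne : (t : ℂ) - 1 / t ≠ 0 := by
    have : t - 1 / t ≠ 0 := by
      have : 1 / t < 1 := by rw [div_lt_one (by linarith)]; exact ht1
      linarith
    exact_mod_cast this
  have h1 := hid n₀ t hz
  have h2 := sub_mul_aeval_genPoly ha b f ((n₀ : ℤ) - 1) hz
  have h3 := congrArg (aeval (xOf a b t)) (hrec n₀ le_rfl)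
  rw [hBb n₀ le_rfl, sub_self, C_0, zero_mul, zero_add, map_mul, aeval_C,
    Complex.coe_algebraMap] at h3
  rw [(hkey n₀ le_rfl).2] at h1
  rw [sub_add_cancel, zpow_natCast, zpow_natCast] at h2
  rw [aeval_jostPoly B hA ha b n₀ hz, ← h3]
  have ha' : (a : ℂ) ≠ 0 := by exact_mod_cast ha.ne'
  refine mul_left_cancel₀ hne ?_
  have e : (t : ℂ) ^ n₀ * (1 / t) ^ n₀ = 1 := by rw [← mul_pow, mul_one_div_cancel hz, one_pow]
  have e' : (t : ℂ) * (1 / t) = 1 := mul_one_div_cancel hz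
  have e2 : (t : ℂ) / a * (a * aeval (xOf a b t) (genPoly a b f (n₀ - 1))) =
      t * aeval (xOf a b t) (genPoly a b f (n₀ - 1)) := by field_simp
  rw [e2]
  simp only [pow_succ] at h1
  generalize aeval (1 / (t : ℂ)) f = F at *
  generalize aeval (t : ℂ) f = G at *
  generalize aeval (xOf a b t) (genPoly a b f (n₀ - 1)) = Q at *
  generalize aeval (xOf a b t) (recPoly A B n₀) = P at *
  generalize (1 / (t : ℂ)) ^ n₀ = W at *
  generalize (1 / (t : ℂ)) = w at *
  generalize (t : ℂ) ^ n₀ = Z at *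
  linear_combination -Z * h1 + Z * t * h2 + (t - w) * G * (-e)

end

/-! ### The main theorem -/

theorem mainTheorem1 (ρ : Measure ℝ) (A B : ℕ → ℝ) (hρ : HasRecurrenceCoefficients ρ A B)
    (a b : ℝ) (ha : 0 < a) (n₀ : ℕ) :
    -- `ψ̂_{n₀}` is a polynomial `Ψ` with real coefficients
    ∃ Ψ : ℝ[X], (∀ z : ℂ, z ≠ 0 → aeval z Ψ = psiHat A B a b n₀ z) ∧
      -- the equivalence
      ((∀ n : ℕ, n₀ ≤ n → A (n + 1) = a ∧ B n = b) ↔ IsBernsteinSzego ρ a b Ψ) ∧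
      -- the converse for a measure generated by a polynomial that is not known to be `ψ̂_{n₀}`
      (∀ f : ℝ[X], f.natDegree ≤ 2 * n₀ → HasJostZeros f → IsBernsteinSzego ρ a b f →
        (∀ n : ℕ, n₀ ≤ n → A (n + 1) = a ∧ B n = b) ∧ f = Ψ) ∧
      -- the degree
      Ψ.natDegree ≤ 2 * n₀ ∧
      (1 ≤ n₀ → A n₀ = a → B (n₀ - 1) ≠ b → Ψ.natDegree = 2 * n₀ - 1) ∧
      (1 ≤ n₀ → A n₀ ≠ a → Ψ.natDegree = 2 * n₀) ∧
      -- the value at `0` and the zeros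
      HasJostZeros Ψ ∧
      -- the values of `p_n` at the zeros, and their exponential decay
      ((∀ n : ℕ, n₀ ≤ n → A (n + 1) = a ∧ B n = b) →
        (∀ z₀ : ℂ, aeval z₀ Ψ = 0 → z₀ ≠ 1 → z₀ ≠ -1 → ∀ n : ℕ, n₀ ≤ n →
          aeval (xOf a b z₀) (recPoly A B n) =
            z₀ ^ (n + 1) * aeval (1 / z₀) Ψ / (z₀ - 1 / z₀)) ∧
        (∀ z₀ : ℂ, aeval z₀ Ψ = 0 → ‖z₀‖ < 1 →
          ∃ K : ℝ, ∀ n : ℕ, ‖aeval (xOf a b z₀) (recPoly A B n)‖ ≤ K * ‖z₀‖ ^ n)) := by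
  have hA := hρ.pos
  have hZ := hasJostZeros_jostPoly B hA ha b n₀
  have hconv : ∀ f : ℝ[X], f.natDegree ≤ 2 * n₀ → HasJostZeros f → IsBernsteinSzego ρ a b f →
      (∀ n : ℕ, n₀ ≤ n → A (n + 1) = a ∧ B n = b) ∧ f = jostPoly A B a b n₀ :=
    fun f hdeg hf h => eq_jostPoly_of_isBernsteinSzego hρ ha hdeg hf h
  -- The converse in part 1 is the case f = ψ̂_{n₀} of part 2, because ψ̂_{n₀} has property (Z) and
  -- the degree bound with no assumption on the tail of the coefficients.
  refine ⟨jostPoly A B a b n₀, fun z hz => aeval_jostPoly_eq_psiHat A B a b n₀ hz,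
    ⟨fun h => isBernsteinSzego_jostPoly hρ ha h,
      fun h => (hconv _ (natDegree_jostPoly_le A B a b n₀) hZ h).1⟩, hconv,
    natDegree_jostPoly_le A B a b n₀, ?_, ?_, hZ, fun h => ⟨?_, ?_⟩⟩
  · intro h1 h2 h3
    obtain ⟨n, rfl⟩ := Nat.exists_eq_succ_of_ne_zero (Nat.one_le_iff_ne_zero.1 h1)
    exact natDegree_jostPoly_of_eq hA ha h2 h3
  · intro h1 h2
    obtain ⟨n, rfl⟩ := Nat.exists_eq_succ_of_ne_zero (Nat.one_le_iff_ne_zero.1 h1)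
    exact natDegree_jostPoly_of_ne B hA ha b n h2
  · exact fun z hz h1 hm n hn => aeval_recPoly_of_aeval_jostPoly_eq_zero hA ha h hz h1 hm hn
  · exact fun z hz h1 => exists_norm_aeval_recPoly_le hA ha h hz h1
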